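/- Let $M$ be a smooth $n$-dimensional manifold with a sub-Riemannian structure $(D,g)$: $D\subset TM$ is a smooth, completely non-integrable sub-bundle of constant rank $k$ and $g$ is a smooth scalar product on $D$. Let $\pi:T^*M\to M$ be the projection, $\theta$ the Liouville form, $\sigma=d\theta$, $\mathcal V=\ker\pi_*$, and let $H(\lambda)=\frac12\sum_{i=1}^k\langle\lambda,X_i\rangle^2$ ($X_1,\dots,X_k$ a local orthonormal frame of $D$) be the sub-Riemannian Hamiltonian, with Hamiltonian vector field $\vec H$ defined by $\sigma(\cdot,\vec H)=dH$. Extremals are the integral curves of $\vec H$; for a vector field $V(t)$ along an extremal put $\dot V(t)=\frac{d}{d\varepsilon}\big|_{\varepsilon=0}e^{-\varepsilon\vec H}_*V(t+\varepsilon)$. For an extremal $\lambda(t)$, $|t|<\varepsilon$, with $H\neq0$ and projection $\gamma$, let $T\in\Gamma(D)$ satisfy $T|_{\gamma(t)}=\dot\gamma(t)$ and put $\mathcal F^i_{\gamma(t)}=\mathrm{span}\{\mathcal L_T^jX|_{\gamma(t)}: X\in\Gamma(D),\ j\le i-1\}$. The geodesic $\gamma$ is equiregular if every $\dim\mathcal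 F^i_{\gamma(t)}$ is independent of $t$, and ample if for every $t$ some $\mathcal F^m_{\gamma(t)}$ is $T_{\gamma(t)}M$. Its Young diagram has columns of length $d_i=\dim\mathcal F^i-\dim\mathcal F^{i-1}$; $n_a$ is the length of the $a$-th row, and $ai$ denotes the $i$-th box of row $a$. Let $N\subset T^*M$ be the set of the covectors $\lambda$ such that, for some $\varepsilon>0$, the extremal with $\lambda(0)=\lambda$ projects for $|t|<\varepsilon$ to an ample and equiregular geodesic. A canonical frame along such an extremal is a smooth moving frame $\{E_{ai},F_{ai}\}$, indexed by the boxes of the Young diagram, with $E_{ai}\in\mathcal V$, $\sigma(E_{ai},E_{bj})=\sigma(F_{ai},F_{bj})=0$, $\sigma(E_{ai},F_{bj})=\delta_{ab}\delta_{ij}$, and, for a smooth matrix $R(t)=(R_{ai,bj}(t))$, $$\dot E_{ai}=E_{a(i-1)}\ (i\ge2),\quad \dot E_{a1}=-F_{a1},\quad \dot F_{ai}=\sum_{bj}R_{ai,bj}E_{bj}-F_{a(i+1)}\ (i<n_a),\quad \dot F_{an_a}=\sum_{bj}R_{an_a,bj}E_{bj},$$ where $R(t)$ is normal: (i) $R_{ai,bj}=R_{bj,ai}$;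 (ii) $R_{ai,b(i+1)}=-R_{bi,a(i+1)}$ if $n_a=n_b$ and $i<n_a$; (iii) if $n_a=n_b$ then $R_{ai,bj}=0$ unless $|i-j|\le1$, and if $n_a>n_b$ then $R_{ai,bj}=0$ unless $(i,j)$ is one of the last $2n_b$ terms of the sequence $(1,1),(1,2),(2,2),\dots,(n_b-1,n_b),(n_b,n_b),(n_b+1,n_b),\dots,(n_a,n_b)$. Let $\mathcal H$ be the canonical Ehresmann connection: a field of subspaces $\mathcal H_\lambda\subset T_\lambda(T^*M)$ with $T_\lambda(T^*M)=\mathcal H_\lambda\oplus\mathcal V_\lambda$ such that, for every $\lambda\in N$, $\mathcal H_\lambda=\mathrm{span}\{F_{ai}(0)\}$ for a canonical frame along the extremal with $\lambda(0)=\lambda$. For $X\in\Gamma(TM)$ let $\nabla_X$ be its horizontal lift, i.e. $\nabla_X\in\mathcal H$ and $\pi_*\nabla_X=X$. **Proposition.** At every point of $N$ one has $\nabla_XH=0$ for every $X\in\Gamma(TM)$ and, equivalently, $\vec H\in\mathcal H$. Moreover, if $\mathcal H$ is a smooth distribution on an open set $U\subset T^*M$, the same holds at every point of $U\cap\overline N$;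 in particular it holds on all of $T^*M$ if $\mathcal H$ is smooth on $T^*M$ and $N$ is dense. -/

import Mathlib

open Set Filter Topology Bundle
open scoped Manifold ContDiff

namespace SubRiemannianGeometry

noncomputable section

/-- The model space `ℝⁿ` of the base manifold. -/
abbrev Model (n : ℕ) : Type := EuclideanSpace ℝ (Fin n)

/-- The model space `ℝⁿ × (ℝⁿ)*` of the cotangent bundle. -/
abbrev CotSpace (n : ℕ) : Type := Model n × (Model n →L[ℝ] ℝ)

/-- The cotangent bundle `T*M`, with its structure of smooth vector bundle (hence of smooth
manifold). A point `ξ` consists of `ξ.proj : M` and of the covector `ξ.2` at `ξ.proj`. -/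
abbrev CotangentBundle (n : ℕ) (M : Type*) [TopologicalSpace M] [ChartedSpace (Model n) M]
    [IsManifold (𝓡 n) ∞ M] : Type _ :=
  TotalSpace (Model n →L[ℝ] ℝ)
    (fun x : M => TangentSpace (𝓡 n) x →L[ℝ] Bundle.Trivial M ℝ x)

/-- The model with corners of `T*M`. -/
abbrev cotModel (n : ℕ) := (𝓡 n).prod 𝓘(ℝ, Model n →L[ℝ] ℝ)

section

variable {n : ℕ} {M : Type*} [TopologicalSpace M] [ChartedSpace (Model n) M]
    [IsManifold (𝓡 n) ∞ M]

/-! ### The symplectic structure of the cotangent bundle -/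

/-- A tangent vector of `T*M` at `ξ`, read in the preferred chart at `ξ` (this is how tangent
vectors of a manifold are represented in Mathlib). -/
def coords {ξ : CotangentBundle n M} (v : TangentSpace (cotModel n) ξ) : CotSpace n := v

/-- The tangent vector of `T*M` at `ξ` with given coordinates in the preferred chart at `ξ`. -/
def ofCoords (ξ : CotangentBundle n M) (y : CotSpace n) : TangentSpace (cotModel n) ξ := y

/-- The differential at `ξ` of the projection `π : T*M → M`. -/
def footDeriv (ξ : CotangentBundle n M) :
    TangentSpace (cotModel n) ξ →L[ℝ] TangentSpace (𝓡 n) ξ.proj :=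
  mfderiv (cotModel n) (𝓡 n) (TotalSpace.proj : CotangentBundle n M → M) ξ

/-- The vertical subspace at `ξ`: the kernel of the differential of the projection. -/
def vertical (ξ : CotangentBundle n M) : Submodule ℝ (TangentSpace (cotModel n) ξ) :=
  LinearMap.ker (footDeriv ξ).toLinearMap

/-- The Liouville one-form `θ_ξ(v) = ⟨ξ, π_* v⟩`. -/
def liouville (ξ : CotangentBundle n M) : TangentSpace (cotModel n) ξ →L[ℝ] ℝ :=
  ξ.2.comp (footDeriv ξ)

/-- The Liouville form written in the preferred chart at `ξ`. -/
def liouvilleInChart (ξ : CotangentBundle n M) (y : CotSpace n) : CotSpace n →L[ℝ] ℝ :=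
  (liouville ((extChartAt (cotModel n) ξ).symm y)).comp
    (mfderiv 𝓘(ℝ, CotSpace n) (cotModel n) (extChartAt (cotModel n) ξ).symm y)

/-- The canonical symplectic form `σ = dθ`, the exterior derivative being computed in the
preferred chart at `ξ`. -/
def symplecticForm (ξ : CotangentBundle n M) (v w : TangentSpace (cotModel n) ξ) : ℝ :=
  fderiv ℝ (liouvilleInChart ξ) (extChartAt (cotModel n) ξ ξ) (coords v) (coords w) -
    fderiv ℝ (liouvilleInChart ξ) (extChartAt (cotModel n) ξ ξ) (coords w) (coords v)

/-- The preferred charts of `T*M` are the canonical coordinates `(q, p)` induced by the charts of `M`. -/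
theorem extChartAt_cot_apply (ξ η : CotangentBundle n M) :
    extChartAt (cotModel n) ξ η = (extChartAt (𝓡 n) ξ.proj η.proj,
      ContinuousLinearMap.inCoordinates (Model n) (TangentSpace (𝓡 n) : M → Type _) ℝ
        (Bundle.Trivial M ℝ) ξ.proj η.proj ξ.proj η.proj η.2) := by
  exact congrArg (fun z : CotSpace n => ((𝓡 n) z.1, z.2))
    (hom_chart (𝕜 := ℝ) (HB := EuclideanSpace ℝ (Fin n)) ξ η)

/-- In the preferred charts the Liouville form is `p dq`. -/
theorem liouvilleInChart_eq (ξ : CotangentBundle n M) {y : CotSpace n}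
    (hy : y ∈ (extChartAt (cotModel n) ξ).target) :
    liouvilleInChart ξ y = y.2.comp (ContinuousLinearMap.fst ℝ _ _) := by
  set φ := extChartAt (cotModel n) ξ with hφ
  set η := φ.symm y with hη
  have hηy : φ η = y := φ.right_inv hy
  have hηs : η ∈ φ.source := φ.map_target hy
  have hsrc : ∀ η' ∈ φ.source, η'.proj ∈ (chartAt (EuclideanSpace ℝ (Fin n)) ξ.proj).source := by
    intro η' h'
    rw [hφ, FiberBundle.extChartAt, PartialEquiv.trans_source] at h'
    have h1 := h'.1
    simp only [Trivialization.source_eq, hom_trivializationAt_baseSet] at h1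
    exact h1.1
  have hbase := hsrc η hηs
  have h1 : extChartAt (𝓡 n) ξ.proj η.proj = y.1 := by
    rw [← hηy, hφ, extChartAt_cot_apply]
  have h2 : y.2 = η.2.comp ((trivializationAt (Model n) (TangentSpace (𝓡 n) : M → Type _)
      ξ.proj).symmL ℝ η.proj) := by
    conv_lhs => rw [← hηy, hφ, extChartAt_cot_apply]
    ext v
    simp [ContinuousLinearMap.inCoordinates]
  rw [TangentBundle.symmL_trivializationAt hbase, h1] at h2
  have hπ : MDifferentiableAt (cotModel n) (𝓡 n) (TotalSpace.proj : CotangentBundle n M → M) η :=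
    (Bundle.contMDiffAt_proj (n := 1) _).mdifferentiableAt one_ne_zero
  have hs : MDifferentiableAt 𝓘(ℝ, CotSpace n) (cotModel n) φ.symm y := by
    have := mdifferentiableWithinAt_extChartAt_symm hy
    rwa [ModelWithCorners.range_eq_univ, mdifferentiableWithinAt_univ] at this
  have h3 := mfderiv_comp y hπ hs
  have h4 : (TotalSpace.proj : CotangentBundle n M → M) ∘ φ.symm =ᶠ[𝓝 y]
      (extChartAt (𝓡 n) ξ.proj).symm ∘ Prod.fst := by
    filter_upwards [(isOpen_extChartAt_target ξ).mem_nhds hy] with z hz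
    have hz1 := hsrc _ (φ.map_target hz)
    have : extChartAt (𝓡 n) ξ.proj (φ.symm z).proj = z.1 := by
      conv_rhs => rw [← φ.right_inv hz, hφ, extChartAt_cot_apply]
    simp only [Function.comp_apply]
    rw [← this, (extChartAt (𝓡 n) ξ.proj).left_inv (by simpa using hz1)]
  have hy1 : y.1 ∈ (extChartAt (𝓡 n) ξ.proj).target := by
    rw [← h1]; exact (extChartAt (𝓡 n) ξ.proj).map_source (by simpa using hbase)
  have hs1 : MDifferentiableAt 𝓘(ℝ, Model n) (𝓡 n) (extChartAt (𝓡 n) ξ.proj).symm y.1 := by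
    have := mdifferentiableWithinAt_extChartAt_symm hy1
    rwa [ModelWithCorners.range_eq_univ, mdifferentiableWithinAt_univ] at this
  have h5 : HasMFDerivAt 𝓘(ℝ, CotSpace n) 𝓘(ℝ, Model n)
      (Prod.fst : CotSpace n → Model n) y
      (ContinuousLinearMap.fst ℝ (Model n) (Model n →L[ℝ] ℝ)) :=
    (ContinuousLinearMap.fst ℝ (Model n) (Model n →L[ℝ] ℝ)).hasFDerivAt.hasMFDerivAt
  have h6 := (HasMFDerivAt.comp y hs1.hasMFDerivAt h5).mfderiv
  rw [h4.mfderiv_eq, h6] at h3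
  rw [ModelWithCorners.range_eq_univ, mfderivWithin_univ] at h2
  rw [h2]
  refine ContinuousLinearMap.ext fun v => ?_
  have h7 := congrArg (fun L => L v) h3
  exact congrArg η.2 h7.symm

theorem footDeriv_apply (ξ : CotangentBundle n M) (v : TangentSpace (cotModel n) ξ) :
    footDeriv ξ v = (coords v).1 := by
  have hπ : MDifferentiableAt (cotModel n) (𝓡 n) (TotalSpace.proj : CotangentBundle n M → M) ξ :=
    (Bundle.contMDiffAt_proj (n := 1) _).mdifferentiableAt one_ne_zero
  have h : writtenInExtChartAt (cotModel n) (𝓡 n) ξ (TotalSpace.proj : CotangentBundle n M → M)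
      =ᶠ[𝓝 (extChartAt (cotModel n) ξ ξ)] Prod.fst := by
    filter_upwards [(isOpen_extChartAt_target ξ).mem_nhds (mem_extChartAt_target ξ)] with z hz
    simp only [writtenInExtChartAt, Function.comp_apply]
    conv_rhs => rw [← (extChartAt (cotModel n) ξ).right_inv hz, extChartAt_cot_apply]
  rw [footDeriv, hπ.mfderiv, ModelWithCorners.range_eq_univ, fderivWithin_univ, h.fderiv_eq]
  exact congrArg (fun L => L v) (fderiv_fst (𝕜 := ℝ) (p := extChartAt (cotModel n) ξ ξ))

theorem fderiv_of_eventuallyEq_comp_fst {V : Type*} [NormedAddCommGroup V] [NormedSpace ℝ V]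
    {f : V × (V →L[ℝ] ℝ) → V × (V →L[ℝ] ℝ) →L[ℝ] ℝ} {y : V × (V →L[ℝ] ℝ)}
    (h : ∀ᶠ z in 𝓝 y, f z = z.2.comp (ContinuousLinearMap.fst ℝ V (V →L[ℝ] ℝ)))
    (v w : V × (V →L[ℝ] ℝ)) : fderiv ℝ f y v w = v.2 w.1 := by
  have h1 := (HasFDerivAt.clm_comp (hasFDerivAt_snd (𝕜 := ℝ) (p := y))
    (hasFDerivAt_const (ContinuousLinearMap.fst ℝ V (V →L[ℝ] ℝ)) y)).congr_of_eventuallyEq h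
  rw [h1.fderiv]
  simp

/-- In the preferred chart `σ = dp ∧ dq`. -/
theorem symplecticForm_apply (ξ : CotangentBundle n M) (v w : TangentSpace (cotModel n) ξ) :
    symplecticForm ξ v w = (coords v).2 (coords w).1 - (coords w).2 (coords v).1 := by
  have h : ∀ᶠ z in 𝓝 (extChartAt (cotModel n) ξ ξ), liouvilleInChart ξ z =
      z.2.comp (ContinuousLinearMap.fst ℝ (Model n) (Model n →L[ℝ] ℝ)) := by
    filter_upwards [(isOpen_extChartAt_target ξ).mem_nhds (mem_extChartAt_target ξ)] with z hz
    exact liouvilleInChart_eq ξ hz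
  exact congrArg₂ (fun a b : ℝ => a - b) (fderiv_of_eventuallyEq_comp_fst h (coords v) (coords w))
    (fderiv_of_eventuallyEq_comp_fst h (coords w) (coords v))

/-- The symplectic form is nondegenerate. -/
theorem existsUnique_symplecticForm_eq (ξ : CotangentBundle n M)
    (α : TangentSpace (cotModel n) ξ →L[ℝ] ℝ) :
    ∃! v : TangentSpace (cotModel n) ξ, ∀ w, symplecticForm ξ w v = α w := by
  let β : CotSpace n →L[ℝ] ℝ := α
  have hsum : ∀ p : Model n →L[ℝ] ℝ, p = ∑ i, p (EuclideanSpace.single i 1) •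
      (EuclideanSpace.proj i : Model n →L[ℝ] ℝ) := by
    intro p
    refine ContinuousLinearMap.ext fun x => ?_
    conv_lhs => rw [← (EuclideanSpace.basisFun (Fin n) ℝ).sum_repr x]
    simp [mul_comm]
  let q : Model n := WithLp.toLp 2 fun i => β (0, EuclideanSpace.proj i)
  let p : Model n →L[ℝ] ℝ := -(β.comp (ContinuousLinearMap.inl ℝ _ _))
  have hq : ∀ r : Model n →L[ℝ] ℝ, r q = β (0, r) := by
    intro r
    have h1 : β (0, r) = (β.comp (ContinuousLinearMap.inr ℝ _ _)) r := rfl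
    rw [h1]
    conv_rhs => rw [hsum r, map_sum]
    conv_lhs => rw [hsum r]
    simp only [map_smul]
    simp [q]
  have hsol : ∀ w : CotSpace n, w.2 q - p w.1 = β w := by
    intro w
    have h1 : p w.1 = -β (w.1, 0) := rfl
    rw [hq, h1, sub_neg_eq_add, ← map_add]
    simp
  refine ⟨ofCoords ξ (q, p), fun w => ?_, fun v hv => ?_⟩
  · exact (symplecticForm_apply ξ w (ofCoords ξ (q, p))).trans (hsol (coords w))
  · have hv' : ∀ w : CotSpace n, w.2 (coords v).1 - (coords v).2 w.1 = β w := fun w =>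
      (symplecticForm_apply ξ (ofCoords ξ w) v).symm.trans (hv (ofCoords ξ w))
    have h : coords v = (q, p) := by
      refine Prod.ext ?_ ?_
      · ext i
        have h1 := (hv' (0, EuclideanSpace.proj i)).trans (hsol (0, EuclideanSpace.proj i)).symm
        simpa using h1
      · refine ContinuousLinearMap.ext fun x => ?_
        have h1 := (hv' (x, 0)).trans (hsol (x, 0)).symm
        simpa using h1
    exact h

/-- The Hamiltonian vector field of a function `f` on `T*M`: the vector field with
`σ(·, f⃗) = df`. -/
def hamiltonianField (f : CotangentBundle n M → ℝ) (ξ : CotangentBundle n M) :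
    TangentSpace (cotModel n) ξ :=
  (existsUnique_symplecticForm_eq ξ (mfderiv (cotModel n) 𝓘(ℝ, ℝ) f ξ)).choose

theorem symplecticForm_hamiltonianField (f : CotangentBundle n M → ℝ) (ξ : CotangentBundle n M)
    (w : TangentSpace (cotModel n) ξ) :
    symplecticForm ξ w (hamiltonianField f ξ) = mfderiv (cotModel n) 𝓘(ℝ, ℝ) f ξ w :=
  (existsUnique_symplecticForm_eq ξ (mfderiv (cotModel n) 𝓘(ℝ, ℝ) f ξ)).choose_spec.1 w

/-! ### Lie derivative along a curve -/

/-- `Φ` is a smooth local flow of the vector field `Z` near `ξ₀` and for times near `0`. -/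
def IsLocalFlowAt (Z : ∀ ξ : CotangentBundle n M, TangentSpace (cotModel n) ξ)
    (Φ : ℝ → CotangentBundle n M → CotangentBundle n M) (ξ₀ : CotangentBundle n M) : Prop :=
  ContMDiffAt (𝓘(ℝ, ℝ).prod (cotModel n)) (cotModel n) ∞
      (fun p : ℝ × CotangentBundle n M => Φ p.1 p.2) (0, ξ₀) ∧
    ∀ᶠ p in 𝓝 ((0 : ℝ), ξ₀), Φ 0 p.2 = p.2 ∧
      HasMFDerivAt 𝓘(ℝ, ℝ) (cotModel n) (fun s => Φ s p.2) p.1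
        ((1 : ℝ →L[ℝ] ℝ).smulRight (Z (Φ p.1 p.2)))

/-- `W = V̇(t) = d/dε|₀ e^{-εZ}_* V(t+ε)`, for a vector field `V` along an integral curve `lam`
of `Z`. For small `ε` the vector `e^{-εZ}_* V(t+ε)` belongs to the fixed tangent space at
`lam t = e^{-εZ}(lam (t+ε))`. -/
def HasLieDerivAlong (Z : ∀ ξ : CotangentBundle n M, TangentSpace (cotModel n) ξ)
    (lam : ℝ → CotangentBundle n M) (V : ∀ t, TangentSpace (cotModel n) (lam t)) (t : ℝ)
    (W : TangentSpace (cotModel n) (lam t)) : Prop :=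
  ∃ Φ : ℝ → CotangentBundle n M → CotangentBundle n M, IsLocalFlowAt Z Φ (lam t) ∧
    HasDerivAt (fun ε : ℝ =>
      coords (mfderiv (cotModel n) (cotModel n) (Φ (-ε)) (lam (t + ε)) (V (t + ε))))
      (coords W) 0

/-- The vector field `V` along the curve `lam` is smooth on `J`. -/
def IsSmoothAlong (lam : ℝ → CotangentBundle n M) (V : ∀ t, TangentSpace (cotModel n) (lam t))
    (J : Set ℝ) : Prop :=
  ContMDiffOn 𝓘(ℝ, ℝ) (cotModel n).tangent ∞
    (fun t => (⟨lam t, V t⟩ : TangentBundle (cotModel n) (CotangentBundle n M))) J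

/-! ### Sub-Riemannian structures -/

/-- The vector field `X` is smooth on `U`. -/
def IsSmoothFieldOn (X : ∀ x : M, TangentSpace (𝓡 n) x) (U : Set M) : Prop :=
  ContMDiffOn (𝓡 n) (𝓡 n).tangent ∞ (fun x => (⟨x, X x⟩ : TangentBundle (𝓡 n) M)) U

/-- `X ∈ Γ(D)`: a global smooth vector field tangent to the distribution `D`. -/
def IsSection (D : ∀ x : M, Submodule ℝ (TangentSpace (𝓡 n) x))
    (X : ∀ x : M, TangentSpace (𝓡 n) x) : Prop :=
  IsSmoothFieldOn X univ ∧ ∀ x, X x ∈ D x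

/-- Iterated Lie brackets of sections of the distribution `D`. -/
inductive IteratedBracket (D : ∀ x : M, Submodule ℝ (TangentSpace (𝓡 n) x)) :
    (∀ x : M, TangentSpace (𝓡 n) x) → Prop
  | base (X : ∀ x : M, TangentSpace (𝓡 n) x) (hX : IsSection D X) : IteratedBracket D X
  | bracket (X Y : ∀ x : M, TangentSpace (𝓡 n) x) (hX : IteratedBracket D X)
      (hY : IteratedBracket D Y) :
      IteratedBracket D (VectorField.mlieBracket (𝓡 n) X Y)

/-- `X_1, …, X_k` is a smooth frame of `D` on `U`, orthonormal for the scalar products `g`. -/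
def IsOrthonormalFrameOn (D : ∀ x : M, Submodule ℝ (TangentSpace (𝓡 n) x))
    (g : ∀ x : M, LinearMap.BilinForm ℝ (D x)) {k : ℕ}
    (X : Fin k → ∀ x : M, TangentSpace (𝓡 n) x) (U : Set M) : Prop :=
  (∀ i, IsSmoothFieldOn (X i) U) ∧
    ∀ x ∈ U, Submodule.span ℝ (Set.range fun i => X i x) = D x ∧
      ∃ h : ∀ i, X i x ∈ D x, ∀ i j, g x ⟨X i x, h i⟩ ⟨X j x, h j⟩ = if i = j then 1 else 0

variable (n M) in
/-- A sub-Riemannian structure `(M, D, g)`: a smooth, completely non-integrable sub-bundle `D` of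
`TM` with a smooth scalar product `g`. Smoothness of `D` and `g` is expressed by the existence of
smooth local orthonormal frames (equivalent by the Gram-Schmidt process). -/
structure SubRiemannianStructure where
  /-- the distribution -/
  D : ∀ x : M, Submodule ℝ (TangentSpace (𝓡 n) x)
  /-- the scalar product -/
  g : ∀ x : M, LinearMap.BilinForm ℝ (D x)
  /-- the rank of the distribution -/
  rank : ℕ
  symm : ∀ x v w, g x v w = g x w v
  pos_def : ∀ x v, v ≠ 0 → 0 < g x v v
  exists_frame : ∀ x₀ : M, ∃ X : Fin rank → ∀ x : M, TangentSpace (𝓡 n) x,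
    ∃ U : Set M, IsOpen U ∧ x₀ ∈ U ∧ IsOrthonormalFrameOn D g X U
  bracket_generating : ∀ x : M,
    Submodule.span ℝ {v | ∃ X, IteratedBracket D X ∧ v = X x} = ⊤

namespace SubRiemannianStructure

variable (S : SubRiemannianStructure n M)

/-- A local orthonormal frame defined near `x₀`. -/
def frame (x₀ : M) : Fin S.rank → ∀ x : M, TangentSpace (𝓡 n) x :=
  (S.exists_frame x₀).choose

/-- The sub-Riemannian Hamiltonian `H(ξ) = ½ ∑ ⟨ξ, X_i⟩²`, where `X_1, …, X_k` is a local
orthonormal frame (the value does not depend on the frame). -/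
def hamiltonian (ξ : CotangentBundle n M) : ℝ :=
  1 / 2 * ∑ i, (ξ.2 (S.frame ξ.proj i ξ.proj) : ℝ) ^ 2

/-- An extremal: an integral curve of the Hamiltonian vector field of `H`. -/
def IsExtremalOn (lam : ℝ → CotangentBundle n M) (J : Set ℝ) : Prop :=
  IsMIntegralCurveOn lam (hamiltonianField S.hamiltonian) J

/-! ### Geodesic flag and Young diagram -/

/-- `T` is an admissible extension of the tangent vector of `γ`. -/
def IsAdmissibleExtension (γ : ℝ → M) (J : Set ℝ) (T : ∀ x : M, TangentSpace (𝓡 n) x) : Prop :=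
  IsSection S.D T ∧
    ∀ t ∈ J, HasMFDerivAt 𝓘(ℝ, ℝ) (𝓡 n) γ t ((1 : ℝ →L[ℝ] ℝ).smulRight (T (γ t)))

/-- The `i`-th space of the flag, `span {L_T^j X (x) | X ∈ Γ(D), j ≤ i - 1}`. -/
def flag (T : ∀ x : M, TangentSpace (𝓡 n) x) (i : ℕ) (x : M) :
    Submodule ℝ (TangentSpace (𝓡 n) x) :=
  Submodule.span ℝ {v | ∃ X, IsSection S.D X ∧ ∃ j < i,
    v = ((VectorField.mlieBracket (𝓡 n) T)^[j] X) x}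

/-- The dimensions of the flag are constant along the geodesic. -/
def IsEquiregular (T : ∀ x : M, TangentSpace (𝓡 n) x) (γ : ℝ → M) (J : Set ℝ) : Prop :=
  ∀ i, ∀ s ∈ J, ∀ t ∈ J,
    Module.finrank ℝ (S.flag T i (γ s)) = Module.finrank ℝ (S.flag T i (γ t))

/-- At every time the flag reaches the whole tangent space. -/
def IsAmple (T : ∀ x : M, TangentSpace (𝓡 n) x) (γ : ℝ → M) (J : Set ℝ) : Prop :=
  ∀ t ∈ J, ∃ m, Module.finrank ℝ (S.flag T m (γ t)) = n

/-- `μ` is the Young diagram of the geodesic: its `i`-th column has length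
`d_i = dim F^i - dim F^{i-1}` (columns are numbered from `0` in Mathlib). -/
def HasYoungDiagram (T : ∀ x : M, TangentSpace (𝓡 n) x) (γ : ℝ → M) (J : Set ℝ)
    (μ : YoungDiagram) : Prop :=
  ∀ t ∈ J, ∀ i, Module.finrank ℝ (S.flag T (i + 1) (γ t)) =
    Module.finrank ℝ (S.flag T i (γ t)) + μ.colLen i

/-- The set `N` of covectors associated with (non-trivial) ample and equiregular geodesics. The
geodesic is considered on a small interval of times around `0`. -/
def regularCovectors : Set (CotangentBundle n M) :=
  {ξ | S.hamiltonian ξ ≠ 0 ∧ ∃ ε > 0, ∃ lam : ℝ → CotangentBundle n M,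
    S.IsExtremalOn lam (Ioo (-ε) ε) ∧ lam 0 = ξ ∧
    ∃ T, S.IsAdmissibleExtension (fun t => (lam t).proj) (Ioo (-ε) ε) T ∧
      S.IsEquiregular T (fun t => (lam t).proj) (Ioo (-ε) ε) ∧
      S.IsAmple T (fun t => (lam t).proj) (Ioo (-ε) ε)}

end SubRiemannianStructure

/-! ### Canonical frames -/

/-- The `k`-th pair, `k = 0, …, n_a + n_b - 2`, of the sequence
`(0,0), (0,1), (1,1), …, (n_b-1,n_b-1), (n_b,n_b-1), …, (n_a-1,n_b-1)` attached to two rows of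
lengths `n_a > n_b` (boxes of a row are numbered from `0`; only `n_b` is needed). -/
def normalPair (nb k : ℕ) : ℕ × ℕ :=
  if k < 2 * nb - 1 then (k / 2, (k + 1) / 2) else (k - (nb - 1), nb - 1)

/-- The normality conditions for a matrix indexed by the boxes `(a, i)` of a Young diagram. In the
third vanishing condition the pair `(i, j)` is one of the last `2 n_b` of the `n_a + n_b - 1` pairs
of the sequence `normalPair`; entries with `n_a < n_b` are covered by the symmetry. -/
structure IsNormal (μ : YoungDiagram) (R : ℕ × ℕ → ℕ × ℕ → ℝ) : Prop where
  symm : ∀ c ∈ μ, ∀ d ∈ μ, R c d = R d c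
  skew : ∀ a b i, (a, i + 1) ∈ μ → (b, i + 1) ∈ μ → μ.rowLen a = μ.rowLen b →
    R (a, i) (b, i + 1) = -R (b, i) (a, i + 1)
  vanish_same : ∀ a i b j, (a, i) ∈ μ → (b, j) ∈ μ → μ.rowLen a = μ.rowLen b →
    R (a, i) (b, j) ≠ 0 → i ≤ j + 1 ∧ j ≤ i + 1
  vanish_lt : ∀ a i b j, (a, i) ∈ μ → (b, j) ∈ μ → μ.rowLen b < μ.rowLen a →
    R (a, i) (b, j) ≠ 0 →
      ∃ k, μ.rowLen a + μ.rowLen b - 1 - 2 * μ.rowLen b ≤ k ∧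
        k < μ.rowLen a + μ.rowLen b - 1 ∧ normalPair (μ.rowLen b) k = (i, j)

/-- `{E_{ai}, F_{ai}}` is a canonical moving frame, with curvature matrix `R`, along the
extremal `lam` with Young diagram `μ`, where a dot is the Lie derivative along the field `Z`. The
box `(a, i)` is in row `a` and column `i`, both numbered from `0`. -/
structure IsCanonicalFrame (Z : ∀ ξ : CotangentBundle n M, TangentSpace (cotModel n) ξ)
    (lam : ℝ → CotangentBundle n M) (J : Set ℝ) (μ : YoungDiagram)
    (E F : ℕ × ℕ → ∀ t, TangentSpace (cotModel n) (lam t))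
    (R : ℝ → ℕ × ℕ → ℕ × ℕ → ℝ) : Prop where
  smooth_E : ∀ c ∈ μ, IsSmoothAlong lam (E c) J
  smooth_F : ∀ c ∈ μ, IsSmoothAlong lam (F c) J
  smooth_R : ∀ c ∈ μ, ∀ d ∈ μ, ContDiffOn ℝ ∞ (fun t => R t c d) J
  span_eq_top : ∀ t ∈ J,
    Submodule.span ℝ ({v | ∃ c ∈ μ, v = E c t} ∪ {v | ∃ c ∈ μ, v = F c t}) = ⊤
  vertical_E : ∀ t ∈ J, ∀ c ∈ μ, E c t ∈ vertical (lam t)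
  darboux_EE : ∀ t ∈ J, ∀ c ∈ μ, ∀ d ∈ μ, symplecticForm (lam t) (E c t) (E d t) = 0
  darboux_FF : ∀ t ∈ J, ∀ c ∈ μ, ∀ d ∈ μ, symplecticForm (lam t) (F c t) (F d t) = 0
  darboux_EF : ∀ t ∈ J, ∀ c ∈ μ, ∀ d ∈ μ,
    symplecticForm (lam t) (E c t) (F d t) = if c = d then 1 else 0
  deriv_E_succ : ∀ t ∈ J, ∀ a i, (a, i + 1) ∈ μ →
    HasLieDerivAlong Z lam (E (a, i + 1)) t (E (a, i) t)
  deriv_E_first : ∀ t ∈ J, ∀ a, (a, 0) ∈ μ →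
    HasLieDerivAlong Z lam (E (a, 0)) t (-F (a, 0) t)
  deriv_F : ∀ t ∈ J, ∀ a i, (a, i) ∈ μ → i + 1 < μ.rowLen a →
    HasLieDerivAlong Z lam (F (a, i)) t (∑ d ∈ μ.cells, R t (a, i) d • E d t - F (a, i + 1) t)
  deriv_F_last : ∀ t ∈ J, ∀ a i, (a, i) ∈ μ → i + 1 = μ.rowLen a →
    HasLieDerivAlong Z lam (F (a, i)) t (∑ d ∈ μ.cells, R t (a, i) d • E d t)
  normal : ∀ t ∈ J, IsNormal μ (R t)

/-! ### Ehresmann connections -/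

variable (n M) in
/-- A field of horizontal subspaces of `T(T*M)`, complementary to the vertical ones. -/
structure EhresmannConnection where
  /-- the horizontal subspaces -/
  hor : ∀ ξ : CotangentBundle n M, Submodule ℝ (TangentSpace (cotModel n) ξ)
  isCompl : ∀ ξ, IsCompl (hor ξ) (vertical ξ)

namespace EhresmannConnection

variable (A : EhresmannConnection n M)

/-- The horizontal distribution is smooth on `U`: it is locally spanned by smooth vector fields. -/
def IsSmoothOn (U : Set (CotangentBundle n M)) : Prop :=
  ∀ ξ₀ ∈ U, ∃ V ∈ 𝓝 ξ₀, ∃ Y : Fin n → ∀ ξ : CotangentBundle n M, TangentSpace (cotModel n) ξ,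
    (∀ i, ContMDiffOn (cotModel n) (cotModel n).tangent ∞
      (fun ξ => (⟨ξ, Y i ξ⟩ : TangentBundle (cotModel n) (CotangentBundle n M))) V) ∧
    ∀ ξ ∈ V, Submodule.span ℝ (Set.range fun i => Y i ξ) = A.hor ξ

theorem existsUnique_lift (ξ : CotangentBundle n M) (v : TangentSpace (𝓡 n) ξ.proj) :
    ∃! w : TangentSpace (cotModel n) ξ, w ∈ A.hor ξ ∧ footDeriv ξ w = v := by
  have h0 : footDeriv ξ (ofCoords ξ (v, 0)) = v := footDeriv_apply ξ (ofCoords ξ (v, 0))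
  obtain ⟨h, hh, k, hk, hsum⟩ := Submodule.mem_sup.1
    (show ofCoords ξ (v, 0) ∈ A.hor ξ ⊔ vertical ξ by
      rw [(A.isCompl ξ).sup_eq_top]; exact Submodule.mem_top)
  have hk' : footDeriv ξ k = 0 := hk
  have h1 : footDeriv ξ h = v := by
    rw [← h0, ← hsum, ContinuousLinearMap.map_add, hk', add_zero]
  refine ⟨h, ⟨hh, h1⟩, fun w hw => ?_⟩
  have h2 : w - h ∈ vertical ξ := by
    change footDeriv ξ (w - h) = 0
    rw [ContinuousLinearMap.map_sub, hw.2, h1, sub_self]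
  have h3 := (Submodule.disjoint_def.1 (A.isCompl ξ).disjoint) _
    ((A.hor ξ).sub_mem hw.1 hh) h2
  exact sub_eq_zero.1 h3

/-- The horizontal lift at `ξ` of a tangent vector of `M`. -/
def lift (ξ : CotangentBundle n M) (v : TangentSpace (𝓡 n) ξ.proj) :
    TangentSpace (cotModel n) ξ :=
  (A.existsUnique_lift ξ v).choose

/-- `(∇_X f)(ξ)`: the derivative at `ξ` of the function `f` on `T*M` along the horizontal lift
`∇_X` of the vector field `X`. -/
def nabla (X : ∀ x : M, TangentSpace (𝓡 n) x) (f : CotangentBundle n M → ℝ)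
    (ξ : CotangentBundle n M) : ℝ :=
  mfderiv (cotModel n) 𝓘(ℝ, ℝ) f ξ (A.lift ξ (X ξ.proj))

end EhresmannConnection

/-- The canonical Ehresmann connection of the sub-Riemannian structure: for every covector `ξ`
associated with an ample and equiregular geodesic, the horizontal space at `ξ` is the span of the
vectors `F_{ai}` of a canonical frame, at time `0`, along the extremal with initial covector `ξ`
(the span does not depend on the canonical frame). -/
def SubRiemannianStructure.IsCanonicalConnection (S : SubRiemannianStructure n M)
    (A : EhresmannConnection n M) : Prop :=
  ∀ ξ ∈ S.regularCovectors, ∃ ε > 0, ∃ lam : ℝ → CotangentBundle n M,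
    S.IsExtremalOn lam (Ioo (-ε) ε) ∧ lam 0 = ξ ∧
    ∃ T, S.IsAdmissibleExtension (fun t => (lam t).proj) (Ioo (-ε) ε) T ∧
      S.IsEquiregular T (fun t => (lam t).proj) (Ioo (-ε) ε) ∧
      S.IsAmple T (fun t => (lam t).proj) (Ioo (-ε) ε) ∧
    ∃ μ : YoungDiagram, S.HasYoungDiagram T (fun t => (lam t).proj) (Ioo (-ε) ε) μ ∧
    ∃ E F R, IsCanonicalFrame (hamiltonianField S.hamiltonian) lam (Ioo (-ε) ε) μ E F R ∧
      A.hor (lam 0) = Submodule.span ℝ {v | ∃ c ∈ μ, v = F c 0}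

end

end

end SubRiemannianGeometry

open SubRiemannianGeometry

namespace SubRiemannianGeometry

/-! The idea is to compare the Hamiltonian field Z of H with the Euler field e (the generator of
fibrewise dilations) along an extremal. H is quadratic on fibres, so the Lie derivatives along Z are
ė = -Z (`hasChartLieDerivAt_euler`) and Ż = 0 (`hasChartLieDerivAt_hamiltonianField`). The flow of Z
preserves σ, so σ(V, W)' = σ(V̇, W) + σ(V, Ẇ) (`HasChartLieDerivAt.hasDerivAt_symplecticForm`).

Along a canonical frame, with boxes numbered from 0, put x_{ai} = σ(e, F_{ai}) and y_{ai} = -σ(Z,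
F_{ai}). As e is vertical, σ(e, E_{ai}) = 0; differentiating gives σ(Z, E_{a0}) = -x_{a0} and σ(Z,
E_{ai}) = 0 for i ≥ 1. Differentiating these relations, and x and y themselves, gives a closed
system: x_{ai}' = y_{ai} - x_{a(i+1)}, without the last term at the end of a row; x_{a0}' = -y_{a0};
x_{a0} = 0 in rows of length at least 2; y_{ai}' = Σ_b R_{ai,b0} x_{b0} - y_{a(i+1)} before the last
box.

The system forces y = 0 (`eq_zero_of_canonical_system`). A row of length 1 has x' = y and x' = -y.
In a longer row, zeros propagate from x_{a0} = 0 along the row; the only obstruction is the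
curvature coupling to rows of length 1, and normality kills it except at the last two boxes
(`IsNormal.eq_zero_of_rowLen_eq_one`), where it is not needed.

Hence Z is skew-orthogonal to every F. The span of the F's is Lagrangian, so Z is horizontal
(`IsCanonicalFrame.mem_span_of_symplecticForm_eq_zero`), and dH(∇_X) = σ(∇_X, Z) = 0 by isotropy.
For the closure, isotropy and skew-orthogonality to Z are vanishing conditions on continuous
functions built from a smooth horizontal frame, hence closed; together they put Z back in the
horizontal space. -/

theorem two_le_infty : (1 + 1 : WithTop ℕ∞) ≤ ∞ := by
  have : ((2 : ℕ∞) : WithTop ℕ∞) ≤ ((⊤ : ℕ∞) : WithTop ℕ∞) := WithTop.coe_le_coe.2 le_top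
  simpa [one_add_one_eq_two] using this

/-! ### Linear algebra: norms of functionals and the standard symplectic form. -/

/-- The standard symplectic form of `ℝⁿ × (ℝⁿ)*`. -/
def standardForm {n : ℕ} (v w : CotSpace n) : ℝ := v.2 w.1 - w.2 v.1

/-- Both sums are the squared dual norm of `l`. This makes the Hamiltonian independent of the
orthonormal frame. -/
theorem sum_sq_eq_of_orthonormal {W : Type*} [AddCommGroup W] [Module ℝ W]
    {ι : Type*} [Fintype ι] [DecidableEq ι] (B : LinearMap.BilinForm ℝ W)
    (hB : ∀ v w, B v w = B w v) {X Y : ι → W}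
    (hX : Submodule.span ℝ (range X) = ⊤) (hY : Submodule.span ℝ (range Y) = ⊤)
    (hXX : ∀ i j, B (X i) (X j) = if i = j then 1 else 0)
    (hYY : ∀ i j, B (Y i) (Y j) = if i = j then 1 else 0) (l : W →ₗ[ℝ] ℝ) :
    ∑ i, l (X i) ^ 2 = ∑ i, l (Y i) ^ 2 := by
  -- Checking on the spanning vectors suffices, so neither nondegeneracy of `B` nor a basis is
  -- needed.
  have expand : ∀ Z : ι → W, Submodule.span ℝ (range Z) = ⊤ →
      (∀ i j, B (Z i) (Z j) = if i = j then 1 else 0) → ∀ w, l w = ∑ i, B w (Z i) * l (Z i) := by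
    intro Z hZ hZZ w
    have hw : w ∈ Submodule.span ℝ (range Z) := hZ ▸ Submodule.mem_top
    induction hw using Submodule.span_induction with
    | mem x hx => obtain ⟨i, rfl⟩ := hx; simp [hZZ]
    | zero => simp
    | add x y _ _ hx hy => simp [hx, hy, add_mul, Finset.sum_add_distrib]
    | smul a x _ hx => simp [hx, mul_assoc, Finset.mul_sum]
  calc ∑ i, l (X i) ^ 2 = ∑ i, ∑ j, B (X i) (Y j) * l (Y j) * l (X i) := by
        refine Finset.sum_congr rfl fun i _ => ?_
        rw [sq, ← Finset.sum_mul, ← expand Y hY hYY]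
    _ = ∑ j, ∑ i, B (X i) (Y j) * l (Y j) * l (X i) := Finset.sum_comm
    _ = ∑ j, l (Y j) ^ 2 := by
        refine Finset.sum_congr rfl fun j _ => ?_
        rw [sq]
        conv_rhs => rw [expand X hX hXX (Y j), Finset.sum_mul]
        refine Finset.sum_congr rfl fun i _ => ?_
        rw [hB (X i) (Y j), ← expand X hX hXX (Y j)]
        ring

/-- The linear isomorphism `(ℝⁿ × (ℝⁿ)*)* → ℝⁿ × (ℝⁿ)*` induced by the standard form. -/
noncomputable def standardSharp {n : ℕ} (β : CotSpace n →L[ℝ] ℝ) : CotSpace n :=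
  (WithLp.toLp 2 fun i => β (0, EuclideanSpace.proj i),
    -(β.comp (ContinuousLinearMap.inl ℝ (Model n) (Model n →L[ℝ] ℝ))))

theorem contDiffOn_standardSharp {n : ℕ} {β : CotSpace n → CotSpace n →L[ℝ] ℝ}
    {s : Set (CotSpace n)} {m : WithTop ℕ∞} (h : ContDiffOn ℝ m β s) :
    ContDiffOn ℝ m (fun y => standardSharp (β y)) s := by
  refine ContDiffOn.prodMk (contDiffOn_euclidean.2 fun i => ?_) ?_
  · exact h.clm_apply contDiffOn_const
  · exact (h.clm_comp contDiffOn_const).neg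

theorem standardForm_standardSharp {n : ℕ} (w : CotSpace n) (β : CotSpace n →L[ℝ] ℝ) :
    standardForm w (standardSharp β) = β w := by
  have hw2 : w.2 = ∑ i, w.2 (EuclideanSpace.single i 1) •
      (EuclideanSpace.proj i : Model n →L[ℝ] ℝ) := by
    refine ContinuousLinearMap.ext fun x => ?_
    conv_lhs => rw [← (EuclideanSpace.basisFun (Fin n) ℝ).sum_repr x]
    simp [mul_comm]
  have h1 : β (0, w.2) = ∑ i, w.2 (EuclideanSpace.single i 1) * β (0, EuclideanSpace.proj i) := by
    have : β (0, w.2) = (β.comp (ContinuousLinearMap.inr ℝ _ _)) w.2 := rfl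
    rw [this]
    conv_lhs => rw [hw2, map_sum]
    simp
  have h2 : β w = β (w.1, 0) + β (0, w.2) := by rw [← map_add]; simp
  rw [h2, h1]
  have h3 : w.2 (standardSharp β).1 =
      ∑ i, w.2 (EuclideanSpace.single i 1) * β (0, EuclideanSpace.proj i) := by
    conv_lhs => rw [hw2]
    simp [standardSharp]
  have h4 : (standardSharp β).2 w.1 = -β (w.1, 0) := rfl
  rw [standardForm, h3, h4]
  ring

theorem standardForm_left_injective {n : ℕ} {v v' : CotSpace n}
    (h : ∀ w, standardForm w v = standardForm w v') : v = v' := by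
  refine Prod.ext ?_ ?_
  · ext i
    simpa [standardForm] using h (0, EuclideanSpace.proj i)
  · refine ContinuousLinearMap.ext fun x => ?_
    simpa [standardForm] using h (x, 0)

/-! ### Calculus in the model space: linearised flows and Hamiltonian fields. -/

/-- This is the coordinate formula V̇ = V' - DZ·V for the Lie derivative along a curve, with `G` the
flow, `z` the field, `c` the curve and `v` the vector field along it. The minus sign comes from
pulling back with time -ε. -/
theorem hasDerivAt_fderiv_flow {X : Type*} [NormedAddCommGroup X] [NormedSpace ℝ X]
    {G : ℝ × X → X} {z : X → X} {c v : ℝ → X} {c' v' : X}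
    (hG : ContDiffAt ℝ ∞ G (0, c 0)) (hG0 : ∀ᶠ y in 𝓝 (c 0), G (0, y) = y)
    (hz : ∀ᶠ y in 𝓝 (c 0), fderiv ℝ G (0, y) (1, 0) = z y)
    (hc : HasDerivAt c c' 0) (hv : HasDerivAt v v' 0) :
    HasDerivAt (fun ε => fderiv ℝ G (-ε, c ε) (0, v ε)) (v' - fderiv ℝ z (c 0) (v 0)) 0 := by
  have hd2 := ((hG.fderiv_right (m := 1) two_le_infty).differentiableAt one_ne_zero).hasFDerivAt
  have hsymm : IsSymmSndFDerivAt ℝ G (0, c 0) :=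
    hG.isSymmSndFDerivAt (by rw [minSmoothness_of_isRCLikeNormedField]; exact two_le_infty)
  have hdiff : ∀ᶠ q in 𝓝 ((0 : ℝ), c 0), DifferentiableAt ℝ G q := by
    filter_upwards [(hG.of_le (m := 1) (by simp)).eventually (by simp)] with q hq
    exact hq.differentiableAt one_ne_zero
  have hincl : ∀ y : X, HasFDerivAt (fun y : X => ((0 : ℝ), y)) (ContinuousLinearMap.inr ℝ ℝ X) y :=
    fun y => (hasFDerivAt_const (0 : ℝ) y).prodMk (hasFDerivAt_id y)
  have hdiff0 : ∀ᶠ y in 𝓝 (c 0), DifferentiableAt ℝ G (0, y) :=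
    (hincl (c 0)).continuousAt.eventually hdiff
  have hid : ∀ᶠ y in 𝓝 (c 0), ∀ w, fderiv ℝ G (0, y) (0, w) = w := by
    filter_upwards [hG0.eventually_nhds, hdiff0] with y hy hdy w
    have h1 : HasFDerivAt (fun y : X => G (0, y)) _ y := hdy.hasFDerivAt.comp y (hincl y)
    have h2 := (h1.congr_of_eventuallyEq (f₁ := id) (hy.mono fun a ha => ha.symm)).unique
      (hasFDerivAt_id y)
    exact congrArg (fun L => L w) h2
  -- The spatial differential of `G (0, ·) = id` is constant, so moving the base point along `c`
  -- contributes nothing.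
  have hsecond : ∀ u w : X, fderiv ℝ (fderiv ℝ G) (0, c 0) (0, u) (0, w) = 0 := by
    intro u w
    have h1 : HasFDerivAt (fun y : X => fderiv ℝ G (0, y) (0, w)) _ (c 0) :=
      (HasFDerivAt.comp (c 0) (f := fun y : X => ((0 : ℝ), y)) hd2 (hincl (c 0))).clm_apply
        (hasFDerivAt_const ((0 : ℝ), w) _)
    have h2 := (h1.congr_of_eventuallyEq (hid.mono fun a ha => (ha w).symm)).unique
      (hasFDerivAt_const w (c 0))
    simpa using congrArg (fun L => L u) h2
  have hmixed : ∀ w : X, fderiv ℝ (fderiv ℝ G) (0, c 0) (0, w) (1, 0) = fderiv ℝ z (c 0) w := by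
    intro w
    have h1 : HasFDerivAt (fun y : X => fderiv ℝ G (0, y) (1, 0)) _ (c 0) :=
      (HasFDerivAt.comp (c 0) (f := fun y : X => ((0 : ℝ), y)) hd2 (hincl (c 0))).clm_apply
        (hasFDerivAt_const ((1 : ℝ), (0 : X)) _)
    have h2 := (h1.congr_of_eventuallyEq (hz.mono fun a ha => ha.symm)).fderiv
    rw [h2]
    simp
  have hcurve : HasDerivAt (fun ε : ℝ => (-ε, c ε)) ((-1 : ℝ), c') 0 :=
    (hasDerivAt_neg (0 : ℝ)).prodMk hc
  have hd2' : HasFDerivAt (fderiv ℝ G) (fderiv ℝ (fderiv ℝ G) (0, c 0)) (-(0 : ℝ), c 0) := by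
    rw [neg_zero]; exact hd2
  have hD : HasDerivAt (fun ε : ℝ => fderiv ℝ G (-ε, c ε))
      (fderiv ℝ (fderiv ℝ G) (0, c 0) (-1, c')) 0 := by
    have h := hd2'.comp_hasDerivAt (0 : ℝ) hcurve
    exact h
  have hp : HasDerivAt (fun ε : ℝ => ((0 : ℝ), v ε)) (0, v') 0 :=
    (hasDerivAt_const (0 : ℝ) (0 : ℝ)).prodMk hv
  have hmain := hD.clm_apply hp
  refine hmain.congr_deriv ?_
  have e1 : ((-1 : ℝ), c') = -((1 : ℝ), (0 : X)) + (0, c') := by simp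
  rw [e1, map_add, map_neg]
  simp only [neg_zero, add_apply, neg_apply]
  -- Symmetry of the second derivative turns the time derivative of the spatial differential into
  -- the spatial derivative of the velocity, that is, of `z`.
  rw [hsecond, hid.self_of_nhds, hsymm, hmixed]
  abel

/-- The form has constant coefficients, so the defining equation of a Hamiltonian field can be
differentiated with `w` frozen: the linearised field is dual to the Hessian. -/
theorem fderiv_of_eventually_pairing_eq {V : Type*} [NormedAddCommGroup V] [NormedSpace ℝ V]
    {z : V × (V →L[ℝ] ℝ) → V × (V →L[ℝ] ℝ)} {g : V × (V →L[ℝ] ℝ) → ℝ} {y : V × (V →L[ℝ] ℝ)}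
    (hz : DifferentiableAt ℝ z y) (hg : DifferentiableAt ℝ (fderiv ℝ g) y)
    (h : ∀ᶠ x in 𝓝 y, ∀ w : V × (V →L[ℝ] ℝ), w.2 (z x).1 - (z x).2 w.1 = fderiv ℝ g x w)
    (v w : V × (V →L[ℝ] ℝ)) :
    w.2 (fderiv ℝ z y v).1 - (fderiv ℝ z y v).2 w.1 = fderiv ℝ (fderiv ℝ g) y v w := by
  have h1 : HasFDerivAt (fun x => w.2 (z x).1 - (z x).2 w.1) _ y :=
    ((hasFDerivAt_const w.2 y).clm_apply hz.hasFDerivAt.fst).sub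
      (hz.hasFDerivAt.snd.clm_apply (hasFDerivAt_const w.1 y))
  have h2 : HasFDerivAt (fun x => fderiv ℝ g x w) _ y :=
    hg.hasFDerivAt.clm_apply (hasFDerivAt_const w y)
  have h3 := (h2.congr_of_eventuallyEq (h.mono fun x hx => hx w)).unique h1
  have h4 := congrArg (fun L => L v) h3
  simp at h4
  exact h4.symm

/-! ### The differential system of a canonical frame. -/

theorem eq_zero_of_hasDerivAt_of_eqOn_zero {u : ℝ → ℝ} {s : Set ℝ} (hs : IsOpen s)
    (hu : ∀ t ∈ s, u t = 0) {t d : ℝ} (ht : t ∈ s) (h : HasDerivAt u d t) : d = 0 := by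
  refine h.unique ((hasDerivAt_const t (0 : ℝ)).congr_of_eventuallyEq ?_)
  filter_upwards [hs.mem_nhds ht] with r hr using hu r hr

/-- For n_b = 1 the last 2 n_b admissible pairs are (n_a - 2, 0) and (n_a - 1, 0), counting from 0,
and `i` lies before both. -/
theorem IsNormal.eq_zero_of_rowLen_eq_one {μ : YoungDiagram} {R : ℕ × ℕ → ℕ × ℕ → ℝ}
    (hR : IsNormal μ R) {a i b : ℕ} (hi : i + 2 < μ.rowLen a) (hb : μ.rowLen b = 1) :
    R (a, i) (b, 0) = 0 := by
  by_contra hne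
  obtain ⟨k, hk1, -, hk⟩ := hR.vanish_lt a i b 0 (YoungDiagram.mem_iff_lt_rowLen.2 (by omega))
    (YoungDiagram.mem_iff_lt_rowLen.2 (by omega)) (by omega) hne
  rw [hb] at hk1 hk
  unfold normalPair at hk
  split_ifs at hk with h
  · omega
  · have := congrArg Prod.fst hk
    simp at this
    omega

/-- The system of differential equations satisfied by the components of the Euler field in a
canonical frame forces the components `y` to vanish. -/
theorem eq_zero_of_canonical_system {μ : YoungDiagram} {R : ℝ → ℕ × ℕ → ℕ × ℕ → ℝ} {s : Set ℝ}
    (hs : IsOpen s) (hR : ∀ t ∈ s, IsNormal μ (R t)) {x y : ℕ × ℕ → ℝ → ℝ}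
    (hx : ∀ t ∈ s, ∀ a i, i + 1 < μ.rowLen a →
      HasDerivAt (x (a, i)) (y (a, i) t - x (a, i + 1) t) t)
    (hx_last : ∀ t ∈ s, ∀ a i, i + 1 = μ.rowLen a → HasDerivAt (x (a, i)) (y (a, i) t) t)
    (hx_first : ∀ t ∈ s, ∀ a, 0 < μ.rowLen a → HasDerivAt (x (a, 0)) (-y (a, 0) t) t)
    (hx_zero : ∀ t ∈ s, ∀ a, 1 < μ.rowLen a → x (a, 0) t = 0)
    (hy : ∀ t ∈ s, ∀ a i, i + 1 < μ.rowLen a → HasDerivAt (y (a, i))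
      (∑ d ∈ μ.cells, R t (a, i) d * (if d.2 = 0 then x d t else 0) - y (a, i + 1) t) t) :
    ∀ a i, i < μ.rowLen a → ∀ t ∈ s, y (a, i) t = 0 := by
  -- The zeros of y and of the next x must be carried together: each derivative equation at a box
  -- yields the vanishing at the following one. The last y of the row is out of reach here.
  have main : ∀ a i, i + 1 < μ.rowLen a →
      ∀ t ∈ s, y (a, i) t = 0 ∧ x (a, i + 1) t = 0 := by
    intro a i
    induction i with
    | zero =>
      intro hi t ht
      have h1 := eq_zero_of_hasDerivAt_of_eqOn_zero hs (fun r hr => hx_zero r hr a (by omega)) ht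
        (hx_first t ht a (by omega))
      have h2 := eq_zero_of_hasDerivAt_of_eqOn_zero hs (fun r hr => hx_zero r hr a (by omega)) ht
        (hx t ht a 0 hi)
      exact ⟨by linarith, by linarith⟩
    | succ i ih =>
      intro hi
      have hyi : ∀ t ∈ s, y (a, i + 1) t = 0 := by
        intro t ht
        have h1 := eq_zero_of_hasDerivAt_of_eqOn_zero hs (fun r hr => (ih (by omega) r hr).1) ht
          (hy t ht a i (by omega))
        have h2 : ∑ d ∈ μ.cells, R t (a, i) d * (if d.2 = 0 then x d t else 0) = 0 := by
          refine Finset.sum_eq_zero fun d hd => ?_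
          obtain ⟨b, j⟩ := d
          -- Only first-column boxes enter the sum. Those in rows of length at least 2 have x = 0;
          -- those in rows of length 1 are removed by normality.
          rcases Nat.eq_zero_or_pos j with rfl | hj
          · have hb : 0 < μ.rowLen b := YoungDiagram.mem_iff_lt_rowLen.1 hd
            rcases Nat.lt_or_ge 1 (μ.rowLen b) with hb1 | hb1
            · simp [hx_zero t ht b hb1]
            · rw [(hR t ht).eq_zero_of_rowLen_eq_one (by omega) (by omega), zero_mul]
          · simp [hj.ne']
        linarith
      intro t ht
      have h3 := eq_zero_of_hasDerivAt_of_eqOn_zero hs (fun r hr => (ih (by omega) r hr).2) ht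
        (hx t ht a (i + 1) hi)
      exact ⟨hyi t ht, by linarith [hyi t ht]⟩
  intro a i hi t ht
  rcases Nat.lt_or_ge (i + 1) (μ.rowLen a) with h | h
  · exact (main a i h t ht).1
  have hlast : i + 1 = μ.rowLen a := by omega
  cases i with
  | zero =>
    -- The single box of a row of length 1 is both first and last, so x' equals both y and -y.
    have := (hx_last t ht a 0 hlast).unique (hx_first t ht a (by omega))
    linarith
  | succ i =>
    -- At the end of a longer row x vanishes identically and x' = y; no equation for y' is used.
    exact eq_zero_of_hasDerivAt_of_eqOn_zero hs (fun r hr => (main a i (by omega) r hr).2) ht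
      (hx_last t ht a (i + 1) hlast)

/-! ### Second-order Euler identity for fibrewise quadratic functions. -/

theorem hasDerivAt_clm_apply_comp {X : Type*} [NormedAddCommGroup X] [NormedSpace ℝ X]
    {D : X → X →L[ℝ] ℝ} {D' : X →L[ℝ] X →L[ℝ] ℝ} {c w : ℝ → X} {c' w' x : X} {t : ℝ}
    (hD : HasFDerivAt D D' x) (hx : c t = x) (hc : HasDerivAt c c' t) (hw : HasDerivAt w w' t) :
    HasDerivAt (fun s => D (c s) (w s)) (D' c' (w t) + D x w') t := by
  subst hx
  have h : HasDerivAt (fun s => D (c s)) (D' c') t := hD.comp_hasDerivAt t hc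
  exact h.clm_apply hw

/-- Differentiating homogeneity in the point gives Dg(q, cp)(w₁, c w₂) = c² Dg(q, p) w; the
derivative of this in c at c = 1 is the claim. -/
theorem fderiv_fderiv_of_homogeneous {V : Type*} [NormedAddCommGroup V] [NormedSpace ℝ V]
    {g : V × (V →L[ℝ] ℝ) → ℝ} {y : V × (V →L[ℝ] ℝ)} (hg : ContDiffAt ℝ ∞ g y)
    (hom : ∀ᶠ z in 𝓝 y, ∀ c : ℝ, g (z.1, c • z.2) = c ^ 2 * g z) (w : V × (V →L[ℝ] ℝ)) :
    fderiv ℝ (fderiv ℝ g) y (0, y.2) w = 2 * fderiv ℝ g y w - fderiv ℝ g y (0, w.2) := by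
  have hd2 := ((hg.fderiv_right (m := 1) two_le_infty).differentiableAt one_ne_zero).hasFDerivAt
  have hdiff : ∀ᶠ z in 𝓝 y, DifferentiableAt ℝ g z := by
    filter_upwards [(hg.of_le (m := 1) (by simp)).eventually (by simp)] with q hq
    exact hq.differentiableAt one_ne_zero
  have hray : ∀ z : V × (V →L[ℝ] ℝ), HasDerivAt (fun c : ℝ => (z.1, c • z.2)) (0, z.2) 1 := by
    intro z
    have h1 : HasDerivAt (fun c : ℝ => c • z.2) z.2 1 := by
      simpa using (hasDerivAt_id (1 : ℝ)).smul_const z.2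
    exact (hasDerivAt_const (1 : ℝ) z.1).prodMk h1
  have hy1 : (y.1, (1 : ℝ) • y.2) = y := by simp
  have hscaled : ∀ᶠ c : ℝ in 𝓝 1,
      fderiv ℝ g (y.1, c • y.2) (w.1, c • w.2) = c ^ 2 * fderiv ℝ g y w := by
    have h1 : ∀ᶠ c : ℝ in 𝓝 1, DifferentiableAt ℝ g (y.1, c • y.2) := by
      have h2 := (hray y).continuousAt
      exact h2.eventually (by simpa only [hy1] using hdiff)
    filter_upwards [h1] with c hc
    let S : V × (V →L[ℝ] ℝ) →L[ℝ] V × (V →L[ℝ] ℝ) :=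
      (ContinuousLinearMap.fst ℝ V (V →L[ℝ] ℝ)).prod (c • ContinuousLinearMap.snd ℝ V (V →L[ℝ] ℝ))
    have h3 : HasFDerivAt (fun z => g (S z)) ((fderiv ℝ g (S y)).comp S) y :=
      HasFDerivAt.comp y (f := S) (DifferentiableAt.hasFDerivAt hc) S.hasFDerivAt
    have h4 : HasFDerivAt (fun z => c ^ 2 * g z) (c ^ 2 • fderiv ℝ g y) y :=
      hdiff.self_of_nhds.hasFDerivAt.const_mul (c ^ 2)
    have h5 := (h3.congr_of_eventuallyEq (hom.mono fun z hz => (hz c).symm)).unique h4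
    exact congrArg (fun L => L w) h5
  have hleft := hasDerivAt_clm_apply_comp (c := fun c : ℝ => (y.1, c • y.2)) hd2 hy1
    (hray y) (hray w)
  have hright : HasDerivAt (fun c : ℝ => c ^ 2 * fderiv ℝ g y w) (2 * fderiv ℝ g y w) 1 := by
    simpa using (hasDerivAt_pow 2 (1 : ℝ)).mul_const (fderiv ℝ g y w)
  have h := hleft.unique (hright.congr_of_eventuallyEq hscaled)
  simp only [one_smul] at h
  linarith

/-! ### Charts of the cotangent bundle and the symplectic form in a fixed chart. -/

variable {n : ℕ} {M : Type*} [TopologicalSpace M] [ChartedSpace (Model n) M]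
    [IsManifold (𝓡 n) ∞ M]

theorem mem_extChartAt_source_iff (ξ η : CotangentBundle n M) :
    η ∈ (extChartAt (cotModel n) ξ).source ↔ η.proj ∈ (chartAt (Model n) ξ.proj).source := by
  rw [extChartAt_source, FiberBundle.chartedSpace_chartAt]
  simp only [OpenPartialHomeomorph.trans_source, OpenPartialHomeomorph.prod_source,
    OpenPartialHomeomorph.refl_source, mem_inter_iff, mem_preimage, mem_prod, mem_univ, and_true,
    Trivialization.source_eq, hom_trivializationAt_baseSet]
  refine ⟨fun h => h.1.1, fun h => ⟨⟨h, mem_univ _⟩, ?_⟩⟩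
  have e : (trivializationAt (Model n →L[ℝ] ℝ)
      (fun x => TangentSpace (𝓡 n) x →L[ℝ] Trivial M ℝ x) ξ.proj η).1 = η.proj :=
    Trivialization.coe_fst' _ (by rw [hom_trivializationAt_baseSet]; exact ⟨h, mem_univ _⟩)
  exact (congrArg (fun x => x ∈ (chartAt (Model n) ξ.proj).source) e).mpr h

/-- Covectors over one point share a chart, and covectors over distinct points are separated in the
base. The Hausdorff property is needed for uniqueness of integral curves. -/
theorem t2Space_cotangentBundle [T2Space M] : T2Space (CotangentBundle n M) := by
  have : T2Space (ModelProd (Model n) (Model n →L[ℝ] ℝ)) := inferInstanceAs (T2Space (CotSpace n))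
  refine ⟨fun ξ η h => ?_⟩
  by_cases hp : ξ.proj = η.proj
  · have hξ : ξ ∈ (chartAt (ModelProd (Model n) (Model n →L[ℝ] ℝ)) ξ).source := mem_chart_source _ _
    have hη : η ∈ (chartAt (ModelProd (Model n) (Model n →L[ℝ] ℝ)) ξ).source := by
      rw [← extChartAt_source (cotModel n), mem_extChartAt_source_iff, ← hp]
      exact mem_chart_source _ _
    have hne : (chartAt (ModelProd (Model n) (Model n →L[ℝ] ℝ)) ξ) ξ ≠
        (chartAt (ModelProd (Model n) (Model n →L[ℝ] ℝ)) ξ) η :=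
      (chartAt _ ξ).injOn.ne_iff hξ hη |>.2 h
    obtain ⟨u, v, hu, hv, hxu, hxv, huv⟩ := t2_separation hne
    exact ⟨_, _, (chartAt _ ξ).isOpen_inter_preimage hu, (chartAt _ ξ).isOpen_inter_preimage hv,
        ⟨hξ, hxu⟩, ⟨hη, hxv⟩, (huv.preimage _).mono inter_subset_right inter_subset_right⟩
  · obtain ⟨u, v, hu, hv, hxu, hxv, huv⟩ := t2_separation hp
    have hc : Continuous (TotalSpace.proj : CotangentBundle n M → M) :=
      FiberBundle.continuous_proj _ _
    exact ⟨_, _, hu.preimage hc, hv.preimage hc, hxu, hxv, huv.preimage _⟩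

/-- The differential at `η` of the preferred chart at `ξ`. -/
noncomputable def chartDeriv (ξ η : CotangentBundle n M) :
    TangentSpace (cotModel n) η →L[ℝ] CotSpace n :=
  mfderiv (cotModel n) 𝓘(ℝ, CotSpace n) (extChartAt (cotModel n) ξ) η

theorem chartDeriv_eq_fderiv {ξ η : CotangentBundle n M}
    (h : η ∈ (extChartAt (cotModel n) ξ).source) :
    chartDeriv ξ η = fderiv ℝ (extChartAt (cotModel n) ξ ∘ (extChartAt (cotModel n) η).symm)
      (extChartAt (cotModel n) η η) := by
  rw [chartDeriv, (mdifferentiableAt_extChartAt (by simpa using h)).mfderiv,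
    ModelWithCorners.range_eq_univ, fderivWithin_univ]
  rfl

theorem chartDeriv_self (ξ : CotangentBundle n M) (v : TangentSpace (cotModel n) ξ) :
    chartDeriv ξ ξ v = coords v := by
  rw [chartDeriv_eq_fderiv (mem_extChartAt_source ξ)]
  have h : (extChartAt (cotModel n) ξ ∘ (extChartAt (cotModel n) ξ).symm) =ᶠ[
      𝓝 (extChartAt (cotModel n) ξ ξ)] id := by
    filter_upwards [(isOpen_extChartAt_target ξ).mem_nhds (mem_extChartAt_target ξ)] with z hz
    exact (extChartAt (cotModel n) ξ).right_inv hz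
  rw [h.fderiv_eq, fderiv_id]
  rfl

theorem contDiffAt_chart_comp_symm {ξ η : CotangentBundle n M}
    (h : η ∈ (extChartAt (cotModel n) ξ).source) :
    ContDiffAt ℝ ∞ (extChartAt (cotModel n) ξ ∘ (extChartAt (cotModel n) η).symm)
      (extChartAt (cotModel n) η η) := by
  have := contDiffWithinAt_ext_coord_change (I := cotModel n) (n := ∞) ξ η
    (y := extChartAt (cotModel n) η η) (by
      rw [PartialEquiv.trans_source]
      refine ⟨mem_extChartAt_target η, ?_⟩
      rw [mem_preimage, extChartAt_to_inv]
      exact h)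
  rwa [ModelWithCorners.range_eq_univ, contDiffWithinAt_univ] at this

theorem liouville_mfderiv_congr {f g : CotSpace n → CotangentBundle n M} {y : CotSpace n}
    (h : f =ᶠ[𝓝 y] g) (v : CotSpace n) :
    liouville (f y) (mfderiv 𝓘(ℝ, CotSpace n) (cotModel n) f y v) =
      liouville (g y) (mfderiv 𝓘(ℝ, CotSpace n) (cotModel n) g y v) := by
  -- All tangent spaces unfold to `CotSpace n`; a non-dependent codomain for the Liouville form
  -- allows rewriting of the base point.
  let ℓ : CotangentBundle n M → CotSpace n →L[ℝ] ℝ := fun ζ => liouville ζ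
  have h1 : ℓ (f y) = ℓ (g y) := congrArg ℓ h.eq_of_nhds
  have h2 : (mfderiv 𝓘(ℝ, CotSpace n) (cotModel n) f y : CotSpace n →L[ℝ] CotSpace n) =
    mfderiv 𝓘(ℝ, CotSpace n) (cotModel n) g y := h.mfderiv_eq
  have h3 := congrArg (fun L => L v) h2
  exact (congrArg (fun L : CotSpace n →L[ℝ] ℝ => L _) h1).trans (congrArg _ h3)

theorem mdifferentiableAt_chart_symm (ξ : CotangentBundle n M) {y : CotSpace n}
    (hy : y ∈ (extChartAt (cotModel n) ξ).target) :
    MDifferentiableAt 𝓘(ℝ, CotSpace n) (cotModel n) (extChartAt (cotModel n) ξ).symm y := by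
  have := mdifferentiableWithinAt_extChartAt_symm hy
  rwa [ModelWithCorners.range_eq_univ, mdifferentiableWithinAt_univ] at this

/-- Transition maps between preferred charts preserve the form `p dq`. -/
theorem eventually_tautological_transition {ξ η : CotangentBundle n M}
    (h : η ∈ (extChartAt (cotModel n) ξ).source) :
    ∀ᶠ y in 𝓝 (extChartAt (cotModel n) η η), ∀ v : CotSpace n,
      (extChartAt (cotModel n) ξ ((extChartAt (cotModel n) η).symm y)).2
        (fderiv ℝ (extChartAt (cotModel n) ξ ∘ (extChartAt (cotModel n) η).symm) y v).1 =
      y.2 v.1 := by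
  set ψ := extChartAt (cotModel n) ξ ∘ (extChartAt (cotModel n) η).symm with hψ
  have hsm := contDiffAt_chart_comp_symm h
  have hd : ∀ᶠ y in 𝓝 (extChartAt (cotModel n) η η), DifferentiableAt ℝ ψ y := by
    filter_upwards [(hsm.of_le (m := 1) (by simp)).eventually (by simp)] with y hy
    exact hy.differentiableAt one_ne_zero
  have hsrc : ∀ᶠ y in 𝓝 (extChartAt (cotModel n) η η),
      (extChartAt (cotModel n) η).symm y ∈ (extChartAt (cotModel n) ξ).source := by
    refine (continuousAt_extChartAt_symm η).eventually_mem
      ((isOpen_extChartAt_source ξ).mem_nhds (by rwa [extChartAt_to_inv]))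
  filter_upwards [(isOpen_extChartAt_target η).mem_nhds (mem_extChartAt_target η), hd,
    hsrc.eventually_nhds] with y hy hdy hs v
  have hsy := hs.self_of_nhds
  have hψt : ψ y ∈ (extChartAt (cotModel n) ξ).target := (extChartAt (cotModel n) ξ).map_source hsy
  have e1 : liouvilleInChart η y v = y.2 v.1 := by rw [liouvilleInChart_eq η hy]; rfl
  have e2 : liouvilleInChart ξ (ψ y) (fderiv ℝ ψ y v) = (ψ y).2 (fderiv ℝ ψ y v).1 := by
    rw [liouvilleInChart_eq ξ hψt]; rfl
  -- Both charts express the same Liouville form, and the inverse chart at η factors through ψ near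
  -- y.
  have hev : (extChartAt (cotModel n) ξ).symm ∘ ψ =ᶠ[𝓝 y] (extChartAt (cotModel n) η).symm := by
    filter_upwards [hs] with z hz
    exact (extChartAt (cotModel n) ξ).left_inv hz
  have e3 := liouville_mfderiv_congr hev v
  have e4 := mfderiv_comp y (mdifferentiableAt_chart_symm ξ hψt) hdy.mdifferentiableAt
  rw [e4, mfderiv_eq_fderiv] at e3
  rw [← e1]
  refine Eq.trans e2.symm e3

/-- The symplectic form is `dp ∧ dq` in every preferred chart. -/
theorem symplecticForm_eq_standardForm {ξ η : CotangentBundle n M}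
    (h : η ∈ (extChartAt (cotModel n) ξ).source) (v w : TangentSpace (cotModel n) η) :
    symplecticForm η v w = standardForm (chartDeriv ξ η v) (chartDeriv ξ η w) := by
  rw [symplecticForm_apply, chartDeriv_eq_fderiv h]
  set ψ := extChartAt (cotModel n) ξ ∘ (extChartAt (cotModel n) η).symm with hψ
  set y := extChartAt (cotModel n) η η
  have hsm : ContDiffAt ℝ ∞ ψ y := contDiffAt_chart_comp_symm h
  have hd := (hsm.differentiableAt (by simp)).hasFDerivAt
  have hd2 := ((hsm.fderiv_right (m := 1) two_le_infty).differentiableAt one_ne_zero).hasFDerivAt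
  have hsymm : IsSymmSndFDerivAt ℝ ψ y :=
    hsm.isSymmSndFDerivAt (by rw [minSmoothness_of_isRCLikeNormedField]; exact two_le_infty)
  -- Invariance of p dq is differentiated once more. The term with the second derivative of ψ is
  -- symmetric in v and w, so it cancels in the antisymmetrisation; this is the naturality of d.
  have key : ∀ v w : CotSpace n, w.2 v.1 = (fderiv ℝ ψ y w).2 (fderiv ℝ ψ y v).1 +
      (ψ y).2 (fderiv ℝ (fderiv ℝ ψ) y w v).1 := by
    intro v w
    have h1 : HasFDerivAt (fun z : CotSpace n => (ψ z).2 (fderiv ℝ ψ z v).1) _ y :=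
      hd.snd.clm_apply (hd2.clm_apply (hasFDerivAt_const v y)).fst
    have h2 : HasFDerivAt (fun z : CotSpace n => z.2 v.1) _ y :=
      (hasFDerivAt_snd (𝕜 := ℝ) (p := y)).clm_apply (hasFDerivAt_const v.1 y)
    have h3 := (h1.congr_of_eventuallyEq
      ((eventually_tautological_transition h).mono fun z hz => (hz v).symm)).unique h2
    have h4 := congrArg (fun L => L w) h3
    simp at h4
    linarith
  have k1 := key (coords v) (coords w)
  have k2 := key (coords w) (coords v)
  have k3 := hsymm (coords v) (coords w)
  rw [k3] at k2
  change _ = (fderiv ℝ ψ y (coords v)).2 (fderiv ℝ ψ y (coords w)).1 -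
    (fderiv ℝ ψ y (coords w)).2 (fderiv ℝ ψ y (coords v)).1
  linarith

/-! ### Smoothness of the sub-Riemannian Hamiltonian. -/

theorem IsOrthonormalFrameOn.sum_sq_eq {D : ∀ x : M, Submodule ℝ (TangentSpace (𝓡 n) x)}
    {g : ∀ x : M, LinearMap.BilinForm ℝ (D x)} (hg : ∀ x v w, g x v w = g x w v) {k : ℕ}
    {X Y : Fin k → ∀ x : M, TangentSpace (𝓡 n) x} {U V : Set M}
    (hX : IsOrthonormalFrameOn D g X U) (hY : IsOrthonormalFrameOn D g Y V) {x : M}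
    (hxU : x ∈ U) (hxV : x ∈ V) (l : TangentSpace (𝓡 n) x →ₗ[ℝ] ℝ) :
    ∑ i, l (X i x) ^ 2 = ∑ i, l (Y i x) ^ 2 := by
  obtain ⟨hX1, hX2, hX3⟩ := hX.2 x hxU
  obtain ⟨hY1, hY2, hY3⟩ := hY.2 x hxV
  have span_top : ∀ Z : Fin k → TangentSpace (𝓡 n) x, Submodule.span ℝ (range Z) = D x →
      ∀ h : ∀ i, Z i ∈ D x, Submodule.span ℝ (range fun i => (⟨Z i, h i⟩ : D x)) = ⊤ := by
    intro Z hZ h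
    refine Submodule.map_injective_of_injective (D x).subtype_injective ?_
    rw [Submodule.map_span, ← range_comp, Submodule.map_subtype_top]
    exact hZ
  exact sum_sq_eq_of_orthonormal (g x) (hg x) (span_top _ hX1 hX2) (span_top _ hY1 hY2) hX3 hY3
    (l.comp (D x).subtype)

namespace SubRiemannianStructure

variable (S : SubRiemannianStructure n M)

theorem exists_frame_nhds (x₀ : M) :
    ∃ U : Set M, IsOpen U ∧ x₀ ∈ U ∧ IsOrthonormalFrameOn S.D S.g (S.frame x₀) U :=
  (S.exists_frame x₀).choose_spec

theorem contMDiff_hamiltonian : ContMDiff (cotModel n) 𝓘(ℝ, ℝ) ∞ S.hamiltonian := by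
  intro ξ
  obtain ⟨U, hU, hxU, hX⟩ := S.exists_frame_nhds ξ.proj
  have hproj : ContMDiffAt (cotModel n) (𝓡 n) ∞ (TotalSpace.proj : CotangentBundle n M → M) ξ :=
    Bundle.contMDiffAt_proj _
  have hUξ : ∀ᶠ η : CotangentBundle n M in 𝓝 ξ, η.proj ∈ U :=
    hproj.continuousAt.eventually_mem (hU.mem_nhds hxU)
  -- The chosen frame changes with the base point with no continuity; frame independence allows one
  -- frame to be fixed near ξ.
  have heq : S.hamiltonian =ᶠ[𝓝 ξ] fun η =>
      1 / 2 * ∑ i, (η.2 (S.frame ξ.proj i η.proj) : ℝ) ^ 2 := by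
    filter_upwards [hUξ] with η hη
    obtain ⟨V, hV, hxV, hY⟩ := S.exists_frame_nhds η.proj
    exact congrArg (1 / 2 * ·) (hY.sum_sq_eq S.symm hX hxV hη η.2.toLinearMap)
  refine ContMDiffAt.congr_of_eventuallyEq ?_ heq
  have hterm : ∀ i, ContMDiffAt (cotModel n) 𝓘(ℝ, ℝ) ∞
      (fun η : CotangentBundle n M => (η.2 (S.frame ξ.proj i η.proj) : ℝ)) ξ := by
    intro i
    have hXi : ContMDiffAt (cotModel n) (𝓡 n).tangent ∞ (fun η : CotangentBundle n M =>
        (⟨η.proj, S.frame ξ.proj i η.proj⟩ : TangentBundle (𝓡 n) M)) ξ :=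
      ContMDiffAt.comp ξ ((hX.1 i).contMDiffAt (hU.mem_nhds hxU)) hproj
    have hid : ContMDiffAt (cotModel n) (cotModel n) ∞ (fun η : CotangentBundle n M =>
        TotalSpace.mk' (Model n →L[ℝ] ℝ)
          (E := fun x : M => TangentSpace (𝓡 n) x →L[ℝ] Bundle.Trivial M ℝ x) η.proj η.2) ξ :=
      contMDiffAt_id
    have := ContMDiffAt.clm_bundle_apply (E₂ := Bundle.Trivial M ℝ) (F₂ := ℝ) hid hXi
    exact (contMDiffAt_totalSpace.1 this).2
  exact contMDiffAt_const.mul (ContMDiffAt.sum fun i _ => (hterm i).pow 2)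

end SubRiemannianStructure

/-! ### Hamiltonian fields in charts. -/

/-- A vector field on `T*M` written in the preferred chart at `ξ`. -/
noncomputable def fieldInChart (Z : ∀ ξ : CotangentBundle n M, TangentSpace (cotModel n) ξ)
    (ξ : CotangentBundle n M) (y : CotSpace n) : CotSpace n :=
  chartDeriv ξ ((extChartAt (cotModel n) ξ).symm y) (Z ((extChartAt (cotModel n) ξ).symm y))

theorem standardForm_fieldInChart {f : CotangentBundle n M → ℝ}
    (hf : ContMDiff (cotModel n) 𝓘(ℝ, ℝ) ∞ f) (ξ : CotangentBundle n M) {y : CotSpace n}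
    (hy : y ∈ (extChartAt (cotModel n) ξ).target) (w : CotSpace n) :
    standardForm w (fieldInChart (hamiltonianField f) ξ y) =
      fderiv ℝ (f ∘ (extChartAt (cotModel n) ξ).symm) y w := by
  set φ := extChartAt (cotModel n) ξ with hφ
  have hsrc : φ.symm y ∈ φ.source := φ.map_target hy
  have hs : MDifferentiableAt 𝓘(ℝ, CotSpace n) (cotModel n) φ.symm y :=
    mdifferentiableAt_chart_symm ξ hy
  have hc : MDifferentiableAt (cotModel n) 𝓘(ℝ, CotSpace n) φ (φ.symm y) :=
    mdifferentiableAt_extChartAt (by simpa [hφ] using hsrc)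
  have hfd : MDifferentiableAt (cotModel n) 𝓘(ℝ, ℝ) f (φ.symm y) :=
    (hf _).mdifferentiableAt (by simp)
  set v : TangentSpace (cotModel n) (φ.symm y) := mfderiv 𝓘(ℝ, CotSpace n) (cotModel n) φ.symm y w
    with hv
  have h1 : chartDeriv ξ (φ.symm y) v = w := by
    have h2 := mfderiv_comp y hc hs
    have h3 : φ ∘ φ.symm =ᶠ[𝓝 y] id := by
      filter_upwards [(isOpen_extChartAt_target ξ).mem_nhds hy] with z hz using φ.right_inv hz
    rw [h3.mfderiv_eq, mfderiv_id] at h2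
    exact (congrArg (fun L => L w) h2).symm
  have h4 := symplecticForm_hamiltonianField f (φ.symm y) v
  rw [symplecticForm_eq_standardForm hsrc, h1] at h4
  refine h4.trans ?_
  have h5 := mfderiv_comp y hfd hs
  rw [mfderiv_eq_fderiv] at h5
  exact (congrArg (fun L => L w) h5).symm

theorem contDiffOn_comp_chart_symm {f : CotangentBundle n M → ℝ}
    (hf : ContMDiff (cotModel n) 𝓘(ℝ, ℝ) ∞ f) (ξ : CotangentBundle n M) :
    ContDiffOn ℝ ∞ (f ∘ (extChartAt (cotModel n) ξ).symm) (extChartAt (cotModel n) ξ).target :=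
  contMDiffOn_iff_contDiffOn.1 (hf.comp_contMDiffOn (contMDiffOn_extChartAt_symm ξ))

/-- The Hamiltonian field is obtained by choice; this explicit formula is what makes its smoothness
visible. -/
theorem fieldInChart_eq_standardSharp {f : CotangentBundle n M → ℝ}
    (hf : ContMDiff (cotModel n) 𝓘(ℝ, ℝ) ∞ f) (ξ : CotangentBundle n M) {y : CotSpace n}
    (hy : y ∈ (extChartAt (cotModel n) ξ).target) :
    fieldInChart (hamiltonianField f) ξ y =
      standardSharp (fderiv ℝ (f ∘ (extChartAt (cotModel n) ξ).symm) y) :=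
  standardForm_left_injective fun w => by
    rw [standardForm_standardSharp, standardForm_fieldInChart hf ξ hy]

theorem contDiffOn_fieldInChart {f : CotangentBundle n M → ℝ}
    (hf : ContMDiff (cotModel n) 𝓘(ℝ, ℝ) ∞ f) (ξ : CotangentBundle n M) :
    ContDiffOn ℝ ∞ (fieldInChart (hamiltonianField f) ξ) (extChartAt (cotModel n) ξ).target := by
  have h := (contDiffOn_comp_chart_symm hf ξ).fderiv_of_isOpen (m := ∞)
    (isOpen_extChartAt_target ξ) (by simp)
  exact (contDiffOn_standardSharp h).congr fun y hy => fieldInChart_eq_standardSharp hf ξ hy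

/-- This is the bridge between smoothness of sections of the tangent bundle, which is stated in
trivialisations, and computations with `chartDeriv`. -/
theorem trivializationAt_eq_chartDeriv {ξ η : CotangentBundle n M}
    (h : η ∈ (extChartAt (cotModel n) ξ).source) (v : TangentSpace (cotModel n) η) :
    (trivializationAt (CotSpace n) (TangentSpace (cotModel n)) ξ
      (⟨η, v⟩ : TangentBundle (cotModel n) (CotangentBundle n M))).2 = chartDeriv ξ η v := by
  rw [extChartAt_source] at h
  have h1 := TangentBundle.continuousLinearMapAt_trivializationAt (I := cotModel n) h
  rw [chartDeriv, ← h1]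
  have hb : η ∈ (trivializationAt (CotSpace n)
      (TangentSpace (cotModel n) : CotangentBundle n M → Type _) ξ).baseSet := by
    simpa using h
  rw [Trivialization.continuousLinearMapAt_apply, Trivialization.coe_linearMapAt_of_mem _ hb]

theorem contMDiff_hamiltonianField {f : CotangentBundle n M → ℝ}
    (hf : ContMDiff (cotModel n) 𝓘(ℝ, ℝ) ∞ f) :
    ContMDiff (cotModel n) (cotModel n).tangent ∞ (fun ξ =>
      (⟨ξ, hamiltonianField f ξ⟩ : TangentBundle (cotModel n) (CotangentBundle n M))) := by
  intro ξ
  refine (contMDiffAt_section _).2 ?_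
  have hev : (fun η => (trivializationAt (CotSpace n) (TangentSpace (cotModel n)) ξ
      (⟨η, hamiltonianField f η⟩ : TangentBundle (cotModel n) (CotangentBundle n M))).2) =ᶠ[𝓝 ξ]
      fieldInChart (hamiltonianField f) ξ ∘ extChartAt (cotModel n) ξ := by
    filter_upwards [extChartAt_source_mem_nhds (I := cotModel n) ξ] with η hη
    rw [trivializationAt_eq_chartDeriv hη, Function.comp_apply, fieldInChart,
      (extChartAt (cotModel n) ξ).left_inv hη]
  refine ContMDiffAt.congr_of_eventuallyEq ?_ hev
  exact ((contDiffOn_fieldInChart hf ξ).contDiffAt ((isOpen_extChartAt_target ξ).mem_nhds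
    (mem_extChartAt_target ξ))).contMDiffAt.comp ξ contMDiffAt_extChartAt

/-- Since the right-hand side is a Hessian, it is symmetric in v and w; so the linearised field is
infinitesimally symplectic. -/
theorem standardForm_fderiv_skew {f : CotangentBundle n M → ℝ}
    (hf : ContMDiff (cotModel n) 𝓘(ℝ, ℝ) ∞ f) (ξ : CotangentBundle n M) {y : CotSpace n}
    (hy : y ∈ (extChartAt (cotModel n) ξ).target) (v w : CotSpace n) :
    standardForm w (fderiv ℝ (fieldInChart (hamiltonianField f) ξ) y v) =
      fderiv ℝ (fderiv ℝ (f ∘ (extChartAt (cotModel n) ξ).symm)) y v w := by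
  have hnhds := (isOpen_extChartAt_target ξ).mem_nhds hy
  have hH := (((contDiffOn_comp_chart_symm hf ξ).contDiffAt hnhds).fderiv_right (m := 1)
    two_le_infty).differentiableAt one_ne_zero
  refine fderiv_of_eventually_pairing_eq
    (((contDiffOn_fieldInChart hf ξ).contDiffAt hnhds).differentiableAt (by simp)) hH ?_ v w
  filter_upwards [hnhds] with z hz w
  exact standardForm_fieldInChart hf ξ hz w

/-! ### Lie derivatives along integral curves, computed in charts. -/

/-- `V` has Lie derivative `W` along `lam` at time `t`, the Lie derivative being computed in the
preferred chart at `lam t`. -/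
def HasChartLieDerivAt (Z : ∀ ξ : CotangentBundle n M, TangentSpace (cotModel n) ξ)
    (lam : ℝ → CotangentBundle n M) (V : ∀ t, TangentSpace (cotModel n) (lam t)) (t : ℝ)
    (W : TangentSpace (cotModel n) (lam t)) : Prop :=
  HasDerivAt (fun s => chartDeriv (lam t) (lam s) (V s))
    (coords W + fderiv ℝ (fieldInChart Z (lam t)) (extChartAt (cotModel n) (lam t) (lam t))
      (coords (V t))) t

/-- In the chart at `lam t` the form has constant coefficients, so the ordinary product rule
applies. The extra terms σ(DZ·V, W) + σ(V, DZ·W) cancel because the Hessian of `f` is symmetric. -/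
theorem HasChartLieDerivAt.hasDerivAt_symplecticForm {f : CotangentBundle n M → ℝ}
    (hf : ContMDiff (cotModel n) 𝓘(ℝ, ℝ) ∞ f) {lam : ℝ → CotangentBundle n M}
    {V W : ∀ t, TangentSpace (cotModel n) (lam t)} {t : ℝ} (hlam : ContinuousAt lam t)
    {V' W' : TangentSpace (cotModel n) (lam t)}
    (hV : HasChartLieDerivAt (hamiltonianField f) lam V t V')
    (hW : HasChartLieDerivAt (hamiltonianField f) lam W t W') :
    HasDerivAt (fun s => symplecticForm (lam s) (V s) (W s))
      (symplecticForm (lam t) V' (W t) + symplecticForm (lam t) (V t) W') t := by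
  have hs : ∀ᶠ s in 𝓝 t, lam s ∈ (extChartAt (cotModel n) (lam t)).source :=
    hlam.eventually_mem (extChartAt_source_mem_nhds (lam t))
  have hVf := (hasFDerivAt_fst (𝕜 := ℝ)).comp_hasDerivAt t hV
  have hVs := (hasFDerivAt_snd (𝕜 := ℝ)).comp_hasDerivAt t hV
  have hWf := (hasFDerivAt_fst (𝕜 := ℝ)).comp_hasDerivAt t hW
  have hWs := (hasFDerivAt_snd (𝕜 := ℝ)).comp_hasDerivAt t hW
  have h1 : HasDerivAt (fun s => standardForm (chartDeriv (lam t) (lam s) (V s))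
      (chartDeriv (lam t) (lam s) (W s))) _ t :=
    (hVs.clm_apply hWf).sub (hWs.clm_apply hVf)
  have h2 : (fun s => symplecticForm (lam s) (V s) (W s)) =ᶠ[𝓝 t] fun s =>
      standardForm (chartDeriv (lam t) (lam s) (V s)) (chartDeriv (lam t) (lam s) (W s)) := by
    filter_upwards [hs] with s hs
    exact symplecticForm_eq_standardForm hs _ _
  refine (h1.congr_of_eventuallyEq h2).congr_deriv ?_
  rw [symplecticForm_apply, symplecticForm_apply]
  set A := fderiv ℝ (fieldInChart (hamiltonianField f) (lam t)) (extChartAt (cotModel n) (lam t) (lam t)) with hA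
  have k1 := standardForm_fderiv_skew hf (lam t) (mem_extChartAt_target (lam t)) (coords (V t)) (coords (W t))
  have k2 := standardForm_fderiv_skew hf (lam t) (mem_extChartAt_target (lam t)) (coords (W t)) (coords (V t))
  have k3 : IsSymmSndFDerivAt ℝ (f ∘ (extChartAt (cotModel n) (lam t)).symm)
      (extChartAt (cotModel n) (lam t) (lam t)) :=
    ((contDiffOn_comp_chart_symm hf (lam t)).contDiffAt ((isOpen_extChartAt_target (lam t)).mem_nhds
      (mem_extChartAt_target (lam t)))).isSymmSndFDerivAt
        (by rw [minSmoothness_of_isRCLikeNormedField]; exact two_le_infty)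
  rw [k3 (coords (V t)) (coords (W t)), ← k2, ← hA] at k1
  simp only [standardForm] at k1
  have e1 := chartDeriv_self (lam t) (V t)
  have e2 := chartDeriv_self (lam t) (W t)
  simp only [e1, e2, Function.comp_apply, ContinuousLinearMap.coe_fst', ContinuousLinearMap.coe_snd', add_apply, map_add]
  linarith

/-- The condition `F p = ξ` matters: `coords` reads a vector in the preferred chart at its own base
point, which must be the fixed chart at ξ. -/
theorem coords_mfderiv {F : CotangentBundle n M → CotangentBundle n M} {ξ p : CotangentBundle n M}
    (hF : MDifferentiableAt (cotModel n) (cotModel n) F p)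
    (hp : p ∈ (extChartAt (cotModel n) ξ).source) (hFp : F p = ξ)
    (v : TangentSpace (cotModel n) p) :
    coords (mfderiv (cotModel n) (cotModel n) F p v) =
      fderiv ℝ (extChartAt (cotModel n) ξ ∘ F ∘ (extChartAt (cotModel n) ξ).symm)
        (extChartAt (cotModel n) ξ p) (chartDeriv ξ p v) := by
  subst hFp
  set φ := extChartAt (cotModel n) (F p) with hφ
  have hφF : MDifferentiableAt (cotModel n) 𝓘(ℝ, CotSpace n) φ (F p) :=
    mdifferentiableAt_extChartAt (mem_chart_source _ _)
  have hφp : MDifferentiableAt (cotModel n) 𝓘(ℝ, CotSpace n) φ p :=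
    mdifferentiableAt_extChartAt (by simpa [hφ] using hp)
  have hs : MDifferentiableAt 𝓘(ℝ, CotSpace n) (cotModel n) φ.symm (φ p) :=
    mdifferentiableAt_chart_symm _ (φ.map_source hp)
  have hsp : φ.symm (φ p) = p := φ.left_inv hp
  have h1 : MDifferentiableAt (cotModel n) 𝓘(ℝ, CotSpace n) (φ ∘ F) p := hφF.comp p hF
  have h2 : MDifferentiableAt 𝓘(ℝ, CotSpace n) 𝓘(ℝ, CotSpace n) (φ ∘ F ∘ φ.symm) (φ p) :=
    MDifferentiableAt.comp (φ p) (g := φ ∘ F) (by rw [hsp]; exact h1) hs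
  have hev : (φ ∘ F ∘ φ.symm) ∘ φ =ᶠ[𝓝 p] φ ∘ F := by
    filter_upwards [(isOpen_extChartAt_source (F p)).mem_nhds hp] with q hq
    simp [Function.comp_apply, φ.left_inv hq]
  have h3 := mfderiv_comp p h2 hφp
  rw [hev.mfderiv_eq, mfderiv_comp p hφF hF, mfderiv_eq_fderiv] at h3
  rw [← chartDeriv_self]
  exact congrArg (fun L => L v) h3

theorem hasMFDerivAt_of_isMIntegralCurveOn_Ioo
    {Z : ∀ ξ : CotangentBundle n M, TangentSpace (cotModel n) ξ} {lam : ℝ → CotangentBundle n M}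
    {a b t : ℝ} (h : IsMIntegralCurveOn lam Z (Ioo a b)) (ht : t ∈ Ioo a b) :
    HasMFDerivAt 𝓘(ℝ, ℝ) (cotModel n) lam t ((1 : ℝ →L[ℝ] ℝ).smulRight (Z (lam t))) :=
  (h t ht).hasMFDerivAt (isOpen_Ioo.mem_nhds ht)

/-- A local flow carries an integral curve back to its initial point. -/
theorem IsLocalFlowAt.eventually_apply_eq [T2Space M]
    {Z : ∀ ξ : CotangentBundle n M, TangentSpace (cotModel n) ξ}
    (hZ : ContMDiff (cotModel n) (cotModel n).tangent ∞ (fun ξ =>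
      (⟨ξ, Z ξ⟩ : TangentBundle (cotModel n) (CotangentBundle n M))))
    {Φ : ℝ → CotangentBundle n M → CotangentBundle n M} {lam : ℝ → CotangentBundle n M}
    {a b t : ℝ} (hlam : IsMIntegralCurveOn lam Z (Ioo a b)) (ht : t ∈ Ioo a b)
    (hΦ : IsLocalFlowAt Z Φ (lam t)) : ∀ᶠ ε : ℝ in 𝓝 0, Φ (-ε) (lam (t + ε)) = lam t := by
  have := t2Space_cotangentBundle (n := n) (M := M)
  obtain ⟨u, hu, w, hw, huw⟩ := mem_nhds_prod_iff.1 hΦ.2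
  obtain ⟨r, hr, hru⟩ := Metric.mem_nhds_iff.1 hu
  obtain ⟨ρ, hρ, hρJ⟩ := Metric.mem_nhds_iff.1 (isOpen_Ioo.mem_nhds ht)
  have hcont : Tendsto (fun ε : ℝ => lam (t + ε)) (𝓝 0) (𝓝 (lam t)) := by
    have h1 : ContinuousAt lam (t + 0) := by
      rw [add_zero]; exact (hasMFDerivAt_of_isMIntegralCurveOn_Ioo hlam ht).continuousAt
    have h2 := h1.tendsto.comp ((continuous_const_add t).tendsto 0)
    rwa [add_zero] at h2
  -- The flow is controlled for |s| < r, while the shifted curve needs |s| + |ε| < ρ; hence the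
  -- half.
  set δ := min r (ρ / 2) with hδ
  have hδ0 : 0 < δ := lt_min hr (by positivity)
  filter_upwards [hcont hw, Metric.ball_mem_nhds (0 : ℝ) hδ0] with ε hε hεδ
  rw [Metric.mem_ball, Real.dist_eq, sub_zero, abs_lt] at hεδ
  have hδr : δ ≤ r := min_le_left _ _
  have hδρ : δ ≤ ρ / 2 := min_le_right _ _
  have h1 : IsMIntegralCurveOn (fun s => Φ s (lam (t + ε))) Z (Ioo (-δ) δ) := by
    intro s hs
    have hsu : s ∈ u := hru (by
      rw [Metric.mem_ball, Real.dist_eq, sub_zero, abs_lt]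
      exact ⟨by linarith [hs.1], by linarith [hs.2]⟩)
    exact (huw (mk_mem_prod hsu hε)).2.hasMFDerivWithinAt
  have h2 : IsMIntegralCurveOn (lam ∘ (· + (t + ε))) Z (Ioo (-δ) δ) := by
    refine (hlam.comp_add (t + ε)).mono fun s hs => hρJ ?_
    rw [Metric.mem_ball, Real.dist_eq, abs_lt]
    exact ⟨by linarith [hs.1], by linarith [hs.2]⟩
  have h0 : (0 : ℝ) ∈ u := hru (Metric.mem_ball_self hr)
  have h3 := isMIntegralCurveOn_Ioo_eqOn_of_contMDiff_boundaryless (t₀ := 0)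
    ⟨by linarith, hδ0⟩ (hZ.of_le (by simp)) h1 h2
    (by
      have := (huw (mk_mem_prod h0 hε)).1
      simpa using this)
  have h4 := h3 (x := -ε) ⟨by linarith, by linarith⟩
  simpa using h4

theorem hasDerivAt_extChartAt_comp {Z : ∀ ξ : CotangentBundle n M, TangentSpace (cotModel n) ξ}
    {lam : ℝ → CotangentBundle n M} {t : ℝ} {ξ : CotangentBundle n M}
    (hξ : lam t ∈ (extChartAt (cotModel n) ξ).source)
    (h : HasMFDerivAt 𝓘(ℝ, ℝ) (cotModel n) lam t ((1 : ℝ →L[ℝ] ℝ).smulRight (Z (lam t)))) :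
    HasDerivAt (fun s => extChartAt (cotModel n) ξ (lam s)) (chartDeriv ξ (lam t) (Z (lam t))) t := by
  have h1 : MDifferentiableAt (cotModel n) 𝓘(ℝ, CotSpace n) (extChartAt (cotModel n) ξ) (lam t) :=
    mdifferentiableAt_extChartAt (by simpa using hξ)
  have h2 : HasFDerivAt (fun s => extChartAt (cotModel n) ξ (lam s))
      ((chartDeriv ξ (lam t)).comp ((1 : ℝ →L[ℝ] ℝ).smulRight (Z (lam t))) : ℝ →L[ℝ] CotSpace n) t :=
    (HasMFDerivAt.comp t h1.hasMFDerivAt h).hasFDerivAt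
  have h2 := h2.hasDerivAt
  refine h2.congr_deriv ?_
  change chartDeriv ξ (lam t) (((1 : ℝ →L[ℝ] ℝ).smulRight (Z (lam t))) (1 : ℝ)) = _
  exact congrArg (chartDeriv ξ (lam t)) (one_smul ℝ (Z (lam t)))

theorem IsSmoothAlong.differentiableAt_chartDeriv {lam : ℝ → CotangentBundle n M}
    {V : ∀ t, TangentSpace (cotModel n) (lam t)} {a b t : ℝ} (h : IsSmoothAlong lam V (Ioo a b))
    (ht : t ∈ Ioo a b) (hlam : ContinuousAt lam t) :
    DifferentiableAt ℝ (fun s => chartDeriv (lam t) (lam s) (V s)) t := by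
  have h1 := (contMDiffAt_totalSpace.1 (h.contMDiffAt (isOpen_Ioo.mem_nhds ht))).2
  have h2 : (fun s => chartDeriv (lam t) (lam s) (V s)) =ᶠ[𝓝 t] fun s =>
      (trivializationAt (CotSpace n) (TangentSpace (cotModel n)) (lam t)
        (⟨lam s, V s⟩ : TangentBundle (cotModel n) (CotangentBundle n M))).2 := by
    filter_upwards [hlam.eventually_mem (extChartAt_source_mem_nhds (I := cotModel n) (lam t))]
      with s hs
    exact (trivializationAt_eq_chartDeriv hs (V s)).symm
  exact (h1.contDiffAt.differentiableAt (by simp)).congr_of_eventuallyEq h2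

/-- A local flow written in the preferred chart at `ξ`. -/
noncomputable def flowInChart (Φ : ℝ → CotangentBundle n M → CotangentBundle n M)
    (ξ : CotangentBundle n M) (q : ℝ × CotSpace n) : CotSpace n :=
  extChartAt (cotModel n) ξ (Φ q.1 ((extChartAt (cotModel n) ξ).symm q.2))

theorem contMDiffAt_chart_symm (ξ : CotangentBundle n M) :
    ContMDiffAt 𝓘(ℝ, CotSpace n) (cotModel n) ∞ (extChartAt (cotModel n) ξ).symm
      (extChartAt (cotModel n) ξ ξ) :=
  (contMDiffOn_extChartAt_symm ξ).contMDiffAt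
    ((isOpen_extChartAt_target ξ).mem_nhds (mem_extChartAt_target ξ))

theorem IsLocalFlowAt.contDiffAt_flowInChart
    {Z : ∀ ξ : CotangentBundle n M, TangentSpace (cotModel n) ξ}
    {Φ : ℝ → CotangentBundle n M → CotangentBundle n M} {ξ : CotangentBundle n M}
    (hΦ : IsLocalFlowAt Z Φ ξ) :
    ContDiffAt ℝ ∞ (flowInChart Φ ξ) (0, extChartAt (cotModel n) ξ ξ) := by
  set x₀ := extChartAt (cotModel n) ξ ξ with hx₀
  have hsymm0 : (extChartAt (cotModel n) ξ).symm x₀ = ξ := extChartAt_to_inv ξ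
  have hflow0 : Φ 0 ξ = ξ := hΦ.2.self_of_nhds.1
  have hfst : ContMDiffAt 𝓘(ℝ, ℝ × CotSpace n) 𝓘(ℝ, ℝ) ∞
      (Prod.fst : ℝ × CotSpace n → ℝ) (0, x₀) := contDiffAt_fst.contMDiffAt
  have hsnd : ContMDiffAt 𝓘(ℝ, ℝ × CotSpace n) 𝓘(ℝ, CotSpace n) ∞
      (Prod.snd : ℝ × CotSpace n → CotSpace n) (0, x₀) := contDiffAt_snd.contMDiffAt
  have hpair : ContMDiffAt 𝓘(ℝ, ℝ × CotSpace n) (𝓘(ℝ, ℝ).prod (cotModel n)) ∞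
      (fun q : ℝ × CotSpace n => (q.1, (extChartAt (cotModel n) ξ).symm q.2)) (0, x₀) :=
    hfst.prodMk (ContMDiffAt.comp (0, x₀) (contMDiffAt_chart_symm ξ) hsnd)
  have hΦG : ContMDiffAt 𝓘(ℝ, ℝ × CotSpace n) (cotModel n) ∞
      (fun q : ℝ × CotSpace n => Φ q.1 ((extChartAt (cotModel n) ξ).symm q.2)) (0, x₀) := by
    refine ContMDiffAt.comp (g := fun p : ℝ × CotangentBundle n M => Φ p.1 p.2) (0, x₀) ?_ hpair
    rw [hsymm0]; exact hΦ.1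
  have hG := ContMDiffAt.comp (g := extChartAt (cotModel n) ξ) (0, x₀)
    (by rw [hsymm0, hflow0]; exact contMDiffAt_extChartAt (n := ∞)) hΦG
  exact hG.contDiffAt

theorem IsLocalFlowAt.eventually_inChart
    {Z : ∀ ξ : CotangentBundle n M, TangentSpace (cotModel n) ξ}
    {Φ : ℝ → CotangentBundle n M → CotangentBundle n M} {ξ : CotangentBundle n M}
    (hΦ : IsLocalFlowAt Z Φ ξ) :
    ∀ᶠ y in 𝓝 (extChartAt (cotModel n) ξ ξ), flowInChart Φ ξ (0, y) = y ∧
      fderiv ℝ (flowInChart Φ ξ) (0, y) (1, 0) = fieldInChart Z ξ y := by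
  set x₀ := extChartAt (cotModel n) ξ ξ with hx₀
  set φ := extChartAt (cotModel n) ξ with hφ
  have hGd : ∀ᶠ q in 𝓝 ((0 : ℝ), x₀), DifferentiableAt ℝ (flowInChart Φ ξ) q := by
    filter_upwards [(hΦ.contDiffAt_flowInChart.of_le (m := 1) (by simp)).eventually (by simp)]
      with q hq
    exact hq.differentiableAt one_ne_zero
  have hflow : ∀ᶠ y in 𝓝 x₀, Φ 0 (φ.symm y) = φ.symm y ∧
      HasMFDerivAt 𝓘(ℝ, ℝ) (cotModel n) (fun s => Φ s (φ.symm y)) 0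
        ((1 : ℝ →L[ℝ] ℝ).smulRight (Z (Φ 0 (φ.symm y)))) := by
    have h1 : Tendsto (fun y => ((0 : ℝ), φ.symm y)) (𝓝 x₀) (𝓝 (0, ξ)) := by
      have := (continuousAt_extChartAt_symm (I := cotModel n) ξ).tendsto
      rw [extChartAt_to_inv] at this
      exact tendsto_const_nhds.prodMk_nhds this
    exact h1.eventually hΦ.2
  have hd0 : ∀ᶠ y in 𝓝 x₀, DifferentiableAt ℝ (flowInChart Φ ξ) (0, y) :=
    (Continuous.continuousAt (by fun_prop : Continuous fun y : CotSpace n =>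
      ((0 : ℝ), y))).eventually hGd
  filter_upwards [hflow, (isOpen_extChartAt_target ξ).mem_nhds (mem_extChartAt_target ξ), hd0]
    with y hy hyt hyd
  refine ⟨by simp only [flowInChart, ← hφ, hy.1, φ.right_inv hyt], ?_⟩
  have h1 : HasDerivAt (fun s => φ (Φ s (φ.symm y)))
      (chartDeriv ξ (Φ 0 (φ.symm y)) (Z (Φ 0 (φ.symm y)))) 0 :=
    hasDerivAt_extChartAt_comp (lam := fun s => Φ s (φ.symm y))
      (by rw [hy.1]; exact φ.map_target hyt) hy.2
  have h2 : HasDerivAt (fun s : ℝ => (s, y)) ((1 : ℝ), (0 : CotSpace n)) 0 :=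
    (hasDerivAt_id (0 : ℝ)).prodMk (hasDerivAt_const (0 : ℝ) y)
  have h3 : HasDerivAt (fun s => flowInChart Φ ξ (s, y))
      (fderiv ℝ (flowInChart Φ ξ) (0, y) (1, 0)) 0 :=
    HasFDerivAt.comp_hasDerivAt (f := fun s : ℝ => (s, y)) (0 : ℝ) hyd.hasFDerivAt h2
  rw [h3.unique h1, fieldInChart, ← hφ, hy.1]

theorem IsLocalFlowAt.eventually_coords_mfderiv
    {Z : ∀ ξ : CotangentBundle n M, TangentSpace (cotModel n) ξ}
    {Φ : ℝ → CotangentBundle n M → CotangentBundle n M} {ξ : CotangentBundle n M}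
    (hΦ : IsLocalFlowAt Z Φ ξ) :
    ∀ᶠ p in 𝓝 ((0 : ℝ), ξ), Φ p.1 p.2 = ξ → ∀ v : TangentSpace (cotModel n) p.2,
      coords (mfderiv (cotModel n) (cotModel n) (Φ p.1) p.2 v) =
        fderiv ℝ (flowInChart Φ ξ) (p.1, extChartAt (cotModel n) ξ p.2)
          (0, chartDeriv ξ p.2 v) := by
  have hGd : ∀ᶠ q in 𝓝 ((0 : ℝ), extChartAt (cotModel n) ξ ξ),
      DifferentiableAt ℝ (flowInChart Φ ξ) q := by
    filter_upwards [(hΦ.contDiffAt_flowInChart.of_le (m := 1) (by simp)).eventually (by simp)]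
      with q hq
    exact hq.differentiableAt one_ne_zero
  have hchart : ContinuousAt (fun p : ℝ × CotangentBundle n M =>
      (p.1, extChartAt (cotModel n) ξ p.2)) (0, ξ) :=
    continuousAt_fst.prodMk ((continuousAt_extChartAt ξ).comp_of_eq continuousAt_snd rfl)
  have hΦd : ∀ᶠ p in 𝓝 ((0 : ℝ), ξ), MDifferentiableAt (𝓘(ℝ, ℝ).prod (cotModel n))
      (cotModel n) (fun p : ℝ × CotangentBundle n M => Φ p.1 p.2) p := by
    filter_upwards [(contMDiffAt_iff_contMDiffAt_nhds (n := 1) (by simp)).1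
      (hΦ.1.of_le (m := 1) (by simp))] with p hp
    exact hp.mdifferentiableAt one_ne_zero
  have hsrc : ∀ᶠ p in 𝓝 ((0 : ℝ), ξ), p.2 ∈ (extChartAt (cotModel n) ξ).source :=
    continuousAt_snd.eventually_mem (extChartAt_source_mem_nhds ξ)
  filter_upwards [hchart.eventually hGd, hΦd, hsrc] with p h2 h3 h4 h1 v
  have h5 : MDifferentiableAt (cotModel n) (cotModel n) (Φ p.1) p.2 :=
    MDifferentiableAt.comp p.2 (g := fun p : ℝ × CotangentBundle n M => Φ p.1 p.2)
      (f := fun q => (p.1, q)) h3 (mdifferentiableAt_const.prodMk mdifferentiableAt_id)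
  rw [coords_mfderiv h5 h4 h1]
  set y := extChartAt (cotModel n) ξ p.2
  have h6 : HasFDerivAt (fun y : CotSpace n => (p.1, y)) (ContinuousLinearMap.inr ℝ ℝ (CotSpace n))
      y := (hasFDerivAt_const p.1 y).prodMk (hasFDerivAt_id y)
  have h7 : HasFDerivAt (fun y => flowInChart Φ ξ (p.1, y)) _ y :=
    HasFDerivAt.comp y (f := fun y : CotSpace n => (p.1, y)) h2.hasFDerivAt h6
  exact congrArg (fun L => L (chartDeriv ξ p.2 v)) h7.fderiv

/-- Near ε = 0 the backward flow returns `lam (t + ε)` exactly to `lam t`, so all the vectors being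
differentiated are read in one chart and `hasDerivAt_fderiv_flow` applies. The result no longer
mentions the flow. -/
theorem HasLieDerivAlong.hasChartLieDerivAt [T2Space M]
    {Z : ∀ ξ : CotangentBundle n M, TangentSpace (cotModel n) ξ}
    (hZ : ContMDiff (cotModel n) (cotModel n).tangent ∞ (fun ξ =>
      (⟨ξ, Z ξ⟩ : TangentBundle (cotModel n) (CotangentBundle n M))))
    {lam : ℝ → CotangentBundle n M} {a b t : ℝ} (hlam : IsMIntegralCurveOn lam Z (Ioo a b))
    (ht : t ∈ Ioo a b) {V : ∀ t, TangentSpace (cotModel n) (lam t)}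
    (hV : IsSmoothAlong lam V (Ioo a b)) {W : TangentSpace (cotModel n) (lam t)}
    (h : HasLieDerivAlong Z lam V t W) : HasChartLieDerivAt Z lam V t W := by
  obtain ⟨Φ, hΦ, hder⟩ := h
  have hlam' := hasMFDerivAt_of_isMIntegralCurveOn_Ioo hlam ht
  have hVd := (hV.differentiableAt_chartDeriv ht hlam'.continuousAt).hasDerivAt
  have hc : HasDerivAt (fun ε => extChartAt (cotModel n) (lam t) (lam (t + ε)))
      (chartDeriv (lam t) (lam t) (Z (lam t))) 0 := by
    refine HasDerivAt.comp_const_add t 0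
      (f := fun s => extChartAt (cotModel n) (lam t) (lam s)) ?_
    rw [add_zero]
    exact hasDerivAt_extChartAt_comp (mem_extChartAt_source (lam t)) hlam'
  have hv : HasDerivAt (fun ε => chartDeriv (lam t) (lam (t + ε)) (V (t + ε)))
      (deriv (fun s => chartDeriv (lam t) (lam s) (V s)) t) 0 := by
    refine HasDerivAt.comp_const_add t 0
      (f := fun s => chartDeriv (lam t) (lam s) (V s)) ?_
    rw [add_zero]
    exact hVd
  have hc0 : extChartAt (cotModel n) (lam t) (lam (t + 0)) =
      extChartAt (cotModel n) (lam t) (lam t) := by rw [add_zero]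
  have hev0 := hΦ.eventually_inChart
  have hG := hΦ.contDiffAt_flowInChart
  rw [← hc0] at hev0 hG
  have hmain := hasDerivAt_fderiv_flow hG (hev0.mono fun y hy => hy.1)
    (hev0.mono fun y hy => hy.2) hc hv
  have hlamε : Tendsto (fun ε : ℝ => (-ε, lam (t + ε))) (𝓝 0) (𝓝 (0, lam t)) := by
    refine Tendsto.prodMk_nhds (by simpa using (continuous_neg (G := ℝ)).tendsto 0) ?_
    have h1 : ContinuousAt lam (t + 0) := by rw [add_zero]; exact hlam'.continuousAt
    have h2 := h1.tendsto.comp ((continuous_const_add t).tendsto 0)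
    rwa [add_zero] at h2
  have hev : (fun ε : ℝ =>
      coords (mfderiv (cotModel n) (cotModel n) (Φ (-ε)) (lam (t + ε)) (V (t + ε)))) =ᶠ[𝓝 0]
      fun ε => fderiv ℝ (flowInChart Φ (lam t)) (-ε, extChartAt (cotModel n) (lam t) (lam (t + ε)))
        (0, chartDeriv (lam t) (lam (t + ε)) (V (t + ε))) := by
    filter_upwards [hΦ.eventually_apply_eq hZ hlam ht,
      hlamε.eventually hΦ.eventually_coords_mfderiv] with ε h1 h2
    exact h2 h1 (V (t + ε))
  have huniq := hder.unique (hmain.congr_of_eventuallyEq hev)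
  refine hVd.congr_deriv ?_
  have hv0 : chartDeriv (lam t) (lam (t + 0)) (V (t + 0)) = coords (V t) := by
    rw [add_zero]
    exact chartDeriv_self (lam t) (V t)
  rw [huniq, hv0, hc0]
  abel

/-! ### The Euler field and its Lie derivative. -/

/-- The fibrewise dilation of the cotangent bundle. -/
noncomputable def fiberScale (c : ℝ) (η : CotangentBundle n M) : CotangentBundle n M := ⟨η.proj, c • η.2⟩

theorem extChartAt_fiberScale (ξ η : CotangentBundle n M) (c : ℝ) :
    extChartAt (cotModel n) ξ (fiberScale c η) =
      ((extChartAt (cotModel n) ξ η).1, c • (extChartAt (cotModel n) ξ η).2) := by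
  rw [extChartAt_cot_apply, extChartAt_cot_apply]
  refine Prod.ext rfl (ContinuousLinearMap.ext fun v => ?_)
  simp [ContinuousLinearMap.inCoordinates, fiberScale]

theorem fiberScale_mem_source {ξ η : CotangentBundle n M} (c : ℝ)
    (h : η ∈ (extChartAt (cotModel n) ξ).source) :
    fiberScale c η ∈ (extChartAt (cotModel n) ξ).source := by
  rw [mem_extChartAt_source_iff] at h ⊢
  exact h

theorem extChartAt_symm_smul (ξ : CotangentBundle n M) {y : CotSpace n}
    (hy : y ∈ (extChartAt (cotModel n) ξ).target) (c : ℝ) :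
    (extChartAt (cotModel n) ξ).symm (y.1, c • y.2) =
      fiberScale c ((extChartAt (cotModel n) ξ).symm y) := by
  have h1 := fiberScale_mem_source c ((extChartAt (cotModel n) ξ).map_target hy)
  rw [← (extChartAt (cotModel n) ξ).left_inv h1, extChartAt_fiberScale,
    (extChartAt (cotModel n) ξ).right_inv hy]

/-- The Euler field of the cotangent bundle. -/
noncomputable def euler (η : CotangentBundle n M) : TangentSpace (cotModel n) η :=
  ofCoords η (0, (extChartAt (cotModel n) η η).2)

/-- Dilations have the same expression in all preferred charts, so their velocity at c = 1 does too;
the Euler field is chart-independent although defined through one chart. -/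
theorem chartDeriv_euler {ξ η : CotangentBundle n M}
    (h : η ∈ (extChartAt (cotModel n) ξ).source) :
    chartDeriv ξ η (euler η) = (0, (extChartAt (cotModel n) ξ η).2) := by
  rw [chartDeriv_eq_fderiv h]
  set y := extChartAt (cotModel n) η η with hy
  set ψ := extChartAt (cotModel n) ξ ∘ (extChartAt (cotModel n) η).symm with hψ
  have hray : ∀ z : CotSpace n, HasDerivAt (fun c : ℝ => (z.1, c • z.2)) (0, z.2) 1 := by
    intro z
    have h1 : HasDerivAt (fun c : ℝ => c • z.2) z.2 1 := by
      simpa using (hasDerivAt_id (1 : ℝ)).smul_const z.2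
    exact (hasDerivAt_const (1 : ℝ) z.1).prodMk h1
  have hd : HasFDerivAt ψ (fderiv ℝ ψ y) (y.1, (1 : ℝ) • y.2) := by
    have hy1 : (y.1, (1 : ℝ) • y.2) = y := by simp
    rw [hy1]
    exact ((contDiffAt_chart_comp_symm h).differentiableAt (by simp)).hasFDerivAt
  have h1 : HasDerivAt (fun c : ℝ => ψ (y.1, c • y.2)) (fderiv ℝ ψ y (0, y.2)) 1 :=
    HasFDerivAt.comp_hasDerivAt (f := fun c : ℝ => (y.1, c • y.2)) (1 : ℝ) hd (hray y)
  have h2 : (fun c : ℝ => ψ (y.1, c • y.2)) = fun c : ℝ =>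
      ((extChartAt (cotModel n) ξ η).1, c • (extChartAt (cotModel n) ξ η).2) := by
    funext c
    rw [hψ, Function.comp_apply, extChartAt_symm_smul η (mem_extChartAt_target η),
      extChartAt_to_inv, extChartAt_fiberScale]
  rw [h2] at h1
  exact h1.unique (hray (extChartAt (cotModel n) ξ η))

theorem fderiv_fieldInChart_euler {f : CotangentBundle n M → ℝ}
    (hf : ContMDiff (cotModel n) 𝓘(ℝ, ℝ) ∞ f) (hom : ∀ c η, f (fiberScale c η) = c ^ 2 * f η)
    (ξ : CotangentBundle n M) {y : CotSpace n} (hy : y ∈ (extChartAt (cotModel n) ξ).target) :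
    fderiv ℝ (fieldInChart (hamiltonianField f) ξ) y (0, y.2) =
      ((fieldInChart (hamiltonianField f) ξ y).1,
        (2 : ℝ) • (fieldInChart (hamiltonianField f) ξ y).2) := by
  have hnhds := (isOpen_extChartAt_target ξ).mem_nhds hy
  refine standardForm_left_injective fun w => ?_
  have h1 := fderiv_fderiv_of_homogeneous ((contDiffOn_comp_chart_symm hf ξ).contDiffAt hnhds) (by
    filter_upwards [hnhds] with z hz c
    rw [Function.comp_apply, Function.comp_apply, extChartAt_symm_smul ξ hz, hom]) w
  rw [standardForm_fderiv_skew hf ξ hy, h1, ← standardForm_fieldInChart hf ξ hy,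
    ← standardForm_fieldInChart hf ξ hy]
  simp only [standardForm, map_zero, sub_zero]
  rw [smul_apply, smul_eq_mul]
  ring

/-- In coordinates e = (0, p) has ordinary derivative (0, Z_p) along the curve, while homogeneity
gives DZ·e = (Z_q, 2 Z_p); the difference is -Z. -/
theorem hasChartLieDerivAt_euler {f : CotangentBundle n M → ℝ}
    (hf : ContMDiff (cotModel n) 𝓘(ℝ, ℝ) ∞ f) (hom : ∀ c η, f (fiberScale c η) = c ^ 2 * f η)
    {lam : ℝ → CotangentBundle n M} {a b t : ℝ}
    (hlam : IsMIntegralCurveOn lam (hamiltonianField f) (Ioo a b)) (ht : t ∈ Ioo a b) :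
    HasChartLieDerivAt (hamiltonianField f) lam (fun s => euler (lam s)) t
      (-hamiltonianField f (lam t)) := by
  have hlam' := hasMFDerivAt_of_isMIntegralCurveOn_Ioo hlam ht
  have h1 := hasDerivAt_extChartAt_comp (mem_extChartAt_source (lam t)) hlam'
  have h1s : HasDerivAt (fun s => (extChartAt (cotModel n) (lam t) (lam s)).2)
      (chartDeriv (lam t) (lam t) (hamiltonianField f (lam t))).2 t := by
    have h := (hasFDerivAt_snd (𝕜 := ℝ)).comp_hasDerivAt t h1
    exact h
  have h2 : HasDerivAt (fun s => ((0 : Model n), (extChartAt (cotModel n) (lam t) (lam s)).2))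
      (0, (chartDeriv (lam t) (lam t) (hamiltonianField f (lam t))).2) t :=
    (hasDerivAt_const t (0 : Model n)).prodMk h1s
  have h3 : (fun s => chartDeriv (lam t) (lam s) (euler (lam s))) =ᶠ[𝓝 t]
      fun s => ((0 : Model n), (extChartAt (cotModel n) (lam t) (lam s)).2) := by
    filter_upwards [hlam'.continuousAt.eventually_mem
      (extChartAt_source_mem_nhds (I := cotModel n) (lam t))] with s hs
    exact chartDeriv_euler hs
  refine (h2.congr_of_eventuallyEq h3).congr_deriv ?_
  have h4 := fderiv_fieldInChart_euler hf hom (lam t) (mem_extChartAt_target (lam t))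
  have h5 : fieldInChart (hamiltonianField f) (lam t) (extChartAt (cotModel n) (lam t) (lam t)) =
      coords (hamiltonianField f (lam t)) := by
    rw [fieldInChart, extChartAt_to_inv, chartDeriv_self]
  rw [h5] at h4
  have h6 : coords (euler (lam t)) = (0, (extChartAt (cotModel n) (lam t) (lam t)).2) := rfl
  have h7 : coords (-hamiltonianField f (lam t)) = -coords (hamiltonianField f (lam t)) := rfl
  rw [h6, h4, h7, chartDeriv_self]
  refine Prod.ext ?_ ?_
  · simp
  · simp only [Prod.snd_add, Prod.snd_neg, two_smul]
    abel

/-- By the chain rule the ordinary derivative of Z along its own integral curve is DZ·Z, exactly the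
correction term. -/
theorem hasChartLieDerivAt_hamiltonianField {f : CotangentBundle n M → ℝ}
    (hf : ContMDiff (cotModel n) 𝓘(ℝ, ℝ) ∞ f)
    {lam : ℝ → CotangentBundle n M} {a b t : ℝ}
    (hlam : IsMIntegralCurveOn lam (hamiltonianField f) (Ioo a b)) (ht : t ∈ Ioo a b) :
    HasChartLieDerivAt (hamiltonianField f) lam (fun s => hamiltonianField f (lam s)) t 0 := by
  have hlam' := hasMFDerivAt_of_isMIntegralCurveOn_Ioo hlam ht
  have h1 := hasDerivAt_extChartAt_comp (mem_extChartAt_source (lam t)) hlam'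
  have hZ := (((contDiffOn_fieldInChart hf (lam t)).contDiffAt ((isOpen_extChartAt_target
    (lam t)).mem_nhds (mem_extChartAt_target (lam t)))).differentiableAt (by simp)).hasFDerivAt
  have h2 := HasFDerivAt.comp_hasDerivAt (f := fun s => extChartAt (cotModel n) (lam t) (lam s))
    t hZ h1
  have h3 : (fun s => chartDeriv (lam t) (lam s) (hamiltonianField f (lam s))) =ᶠ[𝓝 t]
      fieldInChart (hamiltonianField f) (lam t) ∘
        fun s => extChartAt (cotModel n) (lam t) (lam s) := by
    filter_upwards [hlam'.continuousAt.eventually_mem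
      (extChartAt_source_mem_nhds (I := cotModel n) (lam t))] with s hs
    rw [Function.comp_apply, fieldInChart, (extChartAt (cotModel n) (lam t)).left_inv hs]
  refine (h2.congr_of_eventuallyEq h3).congr_deriv ?_
  have h4 : coords (0 : TangentSpace (cotModel n) (lam t)) = 0 := rfl
  rw [h4, zero_add, chartDeriv_self]

theorem SubRiemannianStructure.hamiltonian_fiberScale (S : SubRiemannianStructure n M) (c : ℝ)
    (η : CotangentBundle n M) : S.hamiltonian (fiberScale c η) = c ^ 2 * S.hamiltonian η := by
  have h : ∀ v, (fiberScale c η).2 v = c * (η.2 v : ℝ) := fun v => rfl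
  simp only [SubRiemannianStructure.hamiltonian, h, mul_pow, ← Finset.mul_sum]
  change 1 / 2 * (c ^ 2 * ∑ i, (η.2 (S.frame η.proj i η.proj) : ℝ) ^ 2) = _
  ring

/-! ### Components of the Hamiltonian field in a canonical frame. -/

/-- The symplectic form with its first argument fixed, as a linear map. -/
noncomputable def symplecticMap (ξ : CotangentBundle n M) (v : TangentSpace (cotModel n) ξ) :
    TangentSpace (cotModel n) ξ →ₗ[ℝ] ℝ where
  toFun := symplecticForm ξ v
  map_add' w w' := by
    have h : coords (w + w') = coords w + coords w' := rfl
    simp only [symplecticForm_apply, h, Prod.fst_add, Prod.snd_add, map_add, add_apply]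
    ring
  map_smul' c w := by
    have h : coords (c • w) = c • coords w := rfl
    simp only [symplecticForm_apply, h, Prod.smul_fst, Prod.smul_snd, map_smul, smul_apply,
      smul_eq_mul, RingHom.id_apply]
    ring

theorem symplecticForm_swap (ξ : CotangentBundle n M) (v w : TangentSpace (cotModel n) ξ) :
    symplecticForm ξ v w = -symplecticForm ξ w v := by
  simp only [symplecticForm_apply]
  ring

theorem symplecticForm_eq_zero_of_vertical {ξ : CotangentBundle n M}
    {v w : TangentSpace (cotModel n) ξ} (hv : v ∈ vertical ξ) (hw : w ∈ vertical ξ) :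
    symplecticForm ξ v w = 0 := by
  have h1 : (coords v).1 = 0 := (footDeriv_apply ξ v).symm.trans hv
  have h2 : (coords w).1 = 0 := (footDeriv_apply ξ w).symm.trans hw
  rw [symplecticForm_apply, h1, h2, map_zero, map_zero, sub_zero]

theorem euler_mem_vertical (ξ : CotangentBundle n M) : euler ξ ∈ vertical ξ :=
  footDeriv_apply ξ (euler ξ)

theorem eq_zero_of_symplecticForm_eq_zero {ξ : CotangentBundle n M}
    {v : TangentSpace (cotModel n) ξ} (h : ∀ w, symplecticForm ξ v w = 0) : v = 0 := by
  refine (existsUnique_symplecticForm_eq ξ 0).unique (y₁ := v) (y₂ := 0) (fun w => ?_) (fun w => ?_)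
  · rw [symplecticForm_swap, h, neg_zero]; rfl
  · exact map_zero (symplecticMap ξ w)

/-- The span of the F's is its own skew-orthogonal. The candidate expansion uses the coefficients
σ(E_c, v); its difference from `v` pairs to zero with the whole Darboux frame. -/
theorem IsCanonicalFrame.mem_span_of_symplecticForm_eq_zero
    {Z : ∀ ξ : CotangentBundle n M, TangentSpace (cotModel n) ξ} {s : Set ℝ}
    {lam : ℝ → CotangentBundle n M} {μ : YoungDiagram}
    {E F : ℕ × ℕ → ∀ t, TangentSpace (cotModel n) (lam t)} {R : ℝ → ℕ × ℕ → ℕ × ℕ → ℝ}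
    (h : IsCanonicalFrame Z lam s μ E F R) {t : ℝ} (ht : t ∈ s)
    {v : TangentSpace (cotModel n) (lam t)}
    (hv : ∀ c ∈ μ, symplecticForm (lam t) v (F c t) = 0) :
    v ∈ Submodule.span ℝ {v | ∃ c ∈ μ, v = F c t} := by
  set u := ∑ c ∈ μ.cells, symplecticForm (lam t) (E c t) v • F c t with hu
  have hmem : u ∈ Submodule.span ℝ {v | ∃ c ∈ μ, v = F c t} :=
    Submodule.sum_mem _ fun c hc => Submodule.smul_mem _ _ (Submodule.subset_span ⟨c, hc, rfl⟩)
  have hmap : ∀ w, symplecticMap (lam t) w u =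
      ∑ c ∈ μ.cells, symplecticForm (lam t) (E c t) v * symplecticForm (lam t) w (F c t) := by
    intro w
    rw [hu, map_sum]
    exact Finset.sum_congr rfl fun c _ => map_smul (symplecticMap (lam t) w) _ _
  have hE : ∀ c ∈ μ, symplecticMap (lam t) (v - u) (E c t) = 0 := by
    intro c hc
    have h1 : symplecticMap (lam t) (E c t) u = symplecticForm (lam t) (E c t) v := by
      rw [hmap, Finset.sum_eq_single c]
      · rw [h.darboux_EF t ht c hc c hc, if_pos rfl, mul_one]
      · intro d hd hdc
        rw [h.darboux_EF t ht c hc d hd, if_neg hdc.symm, mul_zero]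
      · intro hc'; exact absurd hc hc'
    have h2 := map_sub (symplecticMap (lam t) (E c t)) v u
    rw [h1] at h2
    refine (symplecticForm_swap (lam t) (v - u) (E c t)).trans (neg_eq_zero.2 (h2.trans ?_))
    exact sub_self _
  have hF : ∀ c ∈ μ, symplecticMap (lam t) (v - u) (F c t) = 0 := by
    intro c hc
    have h1 : symplecticMap (lam t) (F c t) u = 0 := by
      rw [hmap]
      exact Finset.sum_eq_zero fun d hd => by rw [h.darboux_FF t ht c hc d hd, mul_zero]
    have h2 := map_sub (symplecticMap (lam t) (F c t)) v u
    have h3 : symplecticMap (lam t) (F c t) v = 0 :=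
      (symplecticForm_swap (lam t) (F c t) v).trans (neg_eq_zero.2 (hv c hc))
    rw [h1, h3, sub_zero] at h2
    exact (symplecticForm_swap (lam t) (v - u) (F c t)).trans (neg_eq_zero.2 h2)
  have hker : (⊤ : Submodule ℝ (TangentSpace (cotModel n) (lam t))) ≤
      LinearMap.ker (symplecticMap (lam t) (v - u)) := by
    rw [← h.span_eq_top t ht, Submodule.span_le]
    rintro w (⟨c, hc, rfl⟩ | ⟨c, hc, rfl⟩)
    · exact hE c hc
    · exact hF c hc
  have hzero : v - u = 0 :=
    eq_zero_of_symplecticForm_eq_zero fun w => hker (Submodule.mem_top (x := w))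
  rw [sub_eq_zero.1 hzero]
  exact hmem

/-- The Hamiltonian field of a fibrewise quadratic function has no component along `E`. -/
theorem IsCanonicalFrame.symplecticForm_hamiltonianField_eq_zero [T2Space M]
    {f : CotangentBundle n M → ℝ} {lam : ℝ → CotangentBundle n M} {a b : ℝ} {μ : YoungDiagram}
    {E F : ℕ × ℕ → ∀ t, TangentSpace (cotModel n) (lam t)} {R : ℝ → ℕ × ℕ → ℕ × ℕ → ℝ}
    (h : IsCanonicalFrame (hamiltonianField f) lam (Ioo a b) μ E F R)
    (hf : ContMDiff (cotModel n) 𝓘(ℝ, ℝ) ∞ f) (hom : ∀ c η, f (fiberScale c η) = c ^ 2 * f η)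
    (hlam : IsMIntegralCurveOn lam (hamiltonianField f) (Ioo a b)) {t : ℝ} (ht : t ∈ Ioo a b)
    {c : ℕ × ℕ} (hc : c ∈ μ) :
    symplecticForm (lam t) (hamiltonianField f (lam t)) (F c t) = 0 := by
  set Z := hamiltonianField f with hZ
  have hZs := contMDiff_hamiltonianField hf
  have hcont : ∀ t ∈ Ioo a b, ContinuousAt lam t := fun t ht =>
    (hasMFDerivAt_of_isMIntegralCurveOn_Ioo hlam ht).continuousAt
  have derivEuler : ∀ t ∈ Ioo a b, ∀ (V : ∀ t, TangentSpace (cotModel n) (lam t)) (W),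
      IsSmoothAlong lam V (Ioo a b) → HasLieDerivAlong Z lam V t W →
      HasDerivAt (fun s => symplecticForm (lam s) (euler (lam s)) (V s))
        (-symplecticForm (lam t) (Z (lam t)) (V t) +
          symplecticForm (lam t) (euler (lam t)) W) t := by
    intro t ht V W hV hW
    refine ((hasChartLieDerivAt_euler hf hom hlam ht).hasDerivAt_symplecticForm hf (hcont t ht)
      (hW.hasChartLieDerivAt hZs hlam ht hV)).congr_deriv ?_
    have h1 : symplecticForm (lam t) (-Z (lam t)) (V t) =
        -symplecticForm (lam t) (Z (lam t)) (V t) := by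
      rw [symplecticForm_swap, symplecticForm_swap (lam t) (Z (lam t))]
      exact congrArg Neg.neg (map_neg (symplecticMap (lam t) (V t)) (Z (lam t)))
    rw [h1]
  have derivZ : ∀ t ∈ Ioo a b, ∀ (V : ∀ t, TangentSpace (cotModel n) (lam t)) (W),
      IsSmoothAlong lam V (Ioo a b) → HasLieDerivAlong Z lam V t W →
      HasDerivAt (fun s => symplecticForm (lam s) (Z (lam s)) (V s))
        (symplecticForm (lam t) (Z (lam t)) W) t := by
    intro t ht V W hV hW
    refine ((hasChartLieDerivAt_hamiltonianField hf hlam ht).hasDerivAt_symplecticForm hf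
      (hcont t ht) (hW.hasChartLieDerivAt hZs hlam ht hV)).congr_deriv ?_
    have h1 : symplecticForm (lam t) 0 (V t) = 0 := by
      rw [symplecticForm_swap]
      exact neg_eq_zero.2 (map_zero (symplecticMap (lam t) (V t)))
    rw [h1, zero_add]
  have eulerE : ∀ t ∈ Ioo a b, ∀ d ∈ μ, symplecticForm (lam t) (euler (lam t)) (E d t) = 0 :=
    fun t ht d hd => symplecticForm_eq_zero_of_vertical (euler_mem_vertical _)
      (h.vertical_E t ht d hd)
  have mapNeg : ∀ t (v w : TangentSpace (cotModel n) (lam t)),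
      symplecticForm (lam t) v (-w) = -symplecticForm (lam t) v w :=
    fun t v w => map_neg (symplecticMap (lam t) v) w
  have mapSub : ∀ t (v w w' : TangentSpace (cotModel n) (lam t)),
      symplecticForm (lam t) v (w - w') = symplecticForm (lam t) v w - symplecticForm (lam t) v w' :=
    fun t v w w' => map_sub (symplecticMap (lam t) v) w w'
  have mapSum : ∀ t (v : TangentSpace (cotModel n) (lam t)) (r : ℕ × ℕ → ℝ),
      symplecticForm (lam t) v (∑ d ∈ μ.cells, r d • E d t) =
        ∑ d ∈ μ.cells, r d * symplecticForm (lam t) v (E d t) := by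
    intro t v r
    refine (map_sum (symplecticMap (lam t) v) _ _).trans (Finset.sum_congr rfl fun d _ => ?_)
    exact map_smul (symplecticMap (lam t) v) (r d) (E d t)
  -- Obtained by differentiating σ(e, E) = 0: the derivative of E is -F in the first column and the
  -- preceding E in the others.
  have ZE : ∀ t ∈ Ioo a b, ∀ d ∈ μ, symplecticForm (lam t) (Z (lam t)) (E d t) =
      -(if d.2 = 0 then symplecticForm (lam t) (euler (lam t)) (F d t) else 0) := by
    intro t ht d hd
    obtain ⟨p, i⟩ := d
    cases i with
    | zero =>
      have h1 := eq_zero_of_hasDerivAt_of_eqOn_zero isOpen_Ioo (fun s hs => eulerE s hs _ hd) ht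
        (derivEuler t ht _ _ (h.smooth_E _ hd) (h.deriv_E_first t ht p hd))
      rw [mapNeg] at h1
      simp only [if_true]
      linarith
    | succ i =>
      have hd' : (p, i) ∈ μ := μ.up_left_mem le_rfl (Nat.le_succ i) hd
      have h1 := eq_zero_of_hasDerivAt_of_eqOn_zero isOpen_Ioo (fun s hs => eulerE s hs _ hd) ht
        (derivEuler t ht _ _ (h.smooth_E _ hd) (h.deriv_E_succ t ht p i hd))
      rw [eulerE t ht _ hd'] at h1
      simp only [Nat.succ_ne_zero, if_false]
      linarith
  have mem : ∀ {p i : ℕ}, i < μ.rowLen p → (p, i) ∈ μ := YoungDiagram.mem_iff_lt_rowLen.2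
  have main := eq_zero_of_canonical_system (μ := μ) (R := R) isOpen_Ioo h.normal
    (x := fun d t => symplecticForm (lam t) (euler (lam t)) (F d t))
    (y := fun d t => -symplecticForm (lam t) (Z (lam t)) (F d t)) ?_ ?_ ?_ ?_ ?_ c.1 c.2
    (YoungDiagram.mem_iff_lt_rowLen.1 hc) t ht
  · exact neg_eq_zero.1 main
  · intro t ht p i hi
    have hd : (p, i) ∈ μ := mem (by omega)
    refine (derivEuler t ht _ _ (h.smooth_F _ hd) (h.deriv_F t ht p i hd hi)).congr_deriv ?_
    rw [mapSub, mapSum, Finset.sum_eq_zero fun d hd => by rw [eulerE t ht d hd, mul_zero]]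
    ring
  · intro t ht p i hi
    have hd : (p, i) ∈ μ := mem (by omega)
    refine (derivEuler t ht _ _ (h.smooth_F _ hd) (h.deriv_F_last t ht p i hd hi)).congr_deriv ?_
    rw [mapSum, Finset.sum_eq_zero fun d hd => by rw [eulerE t ht d hd, mul_zero]]
    ring
  · intro t ht p hp
    have hd : (p, 0) ∈ μ := mem hp
    have h1 := derivZ t ht _ _ (h.smooth_E _ hd) (h.deriv_E_first t ht p hd)
    rw [mapNeg] at h1
    -- On the whole interval -σ(Z, E) at a first box equals x, so this derivative is a second
    -- equation for x', independent of the one from differentiating F.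
    have h2 := h1.neg
    refine (h2.congr_of_eventuallyEq ?_).congr_deriv (by ring)
    filter_upwards [isOpen_Ioo.mem_nhds ht] with s hs
    have := ZE s hs _ hd
    simp only [if_true] at this
    rw [Pi.neg_apply, this, neg_neg]
  · intro t ht p hp
    have hd : (p, 1) ∈ μ := mem hp
    have hd0 : (p, 0) ∈ μ := mem (by omega)
    -- σ(Z, E) vanishes identically at the second box of the row, and its derivative is σ(Z, E) at
    -- the first box, which is -x.
    have h1 := eq_zero_of_hasDerivAt_of_eqOn_zero isOpen_Ioo (fun s hs => by
      have := ZE s hs _ hd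
      simpa using this) ht
      (derivZ t ht _ _ (h.smooth_E _ hd) (h.deriv_E_succ t ht p 0 hd))
    have h2 := ZE t ht _ hd0
    simp only [if_true] at h2
    rw [h2] at h1
    exact neg_eq_zero.1 h1
  · intro t ht p i hi
    have hd : (p, i) ∈ μ := mem (by omega)
    refine (derivZ t ht _ _ (h.smooth_F _ hd) (h.deriv_F t ht p i hd hi)).neg.congr_deriv ?_
    rw [mapSub, mapSum, neg_sub, sub_eq_add_neg, add_comm, sub_neg_eq_add,
      ← Finset.sum_neg_distrib]
    refine congrArg₂ (· + ·) (Finset.sum_congr rfl fun d hd => ?_) rfl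
    rw [ZE t ht d hd]
    ring

/-! ### Isotropic horizontal spaces and the result at regular covectors. -/

/-- The horizontal space at `ξ` is isotropic. -/
def EhresmannConnection.IsIsotropicAt (A : EhresmannConnection n M) (ξ : CotangentBundle n M) :
    Prop := ∀ v ∈ A.hor ξ, ∀ w ∈ A.hor ξ, symplecticForm ξ v w = 0

theorem symplecticForm_eq_zero_of_span {ξ : CotangentBundle n M}
    {s t : Set (TangentSpace (cotModel n) ξ)}
    (h : ∀ v ∈ s, ∀ w ∈ t, symplecticForm ξ v w = 0) {v w : TangentSpace (cotModel n) ξ}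
    (hv : v ∈ Submodule.span ℝ s) (hw : w ∈ Submodule.span ℝ t) : symplecticForm ξ v w = 0 := by
  have h1 : ∀ v ∈ s, symplecticForm ξ v w = 0 := fun v hv =>
    (Submodule.span_le (p := LinearMap.ker (symplecticMap ξ v))).2 (fun w hw => h v hv w hw) hw
  have h2 : symplecticForm ξ w v = 0 :=
    (Submodule.span_le (p := LinearMap.ker (symplecticMap ξ w))).2
      (fun v hv => (symplecticForm_swap ξ w v).trans (neg_eq_zero.2 (h1 v hv))) hv
  rw [symplecticForm_swap, h2, neg_zero]

/-- A vector which is skew-orthogonal to an isotropic horizontal space is horizontal. -/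
theorem EhresmannConnection.IsIsotropicAt.mem_hor {A : EhresmannConnection n M}
    {ξ : CotangentBundle n M} (hA : A.IsIsotropicAt ξ) {z : TangentSpace (cotModel n) ξ}
    (hz : ∀ w ∈ A.hor ξ, symplecticForm ξ w z = 0) : z ∈ A.hor ξ := by
  obtain ⟨h, hh, v, hv, rfl⟩ := Submodule.mem_sup.1
    (show z ∈ A.hor ξ ⊔ vertical ξ by rw [(A.isCompl ξ).sup_eq_top]; exact Submodule.mem_top)
  -- The vertical part of z is skew-orthogonal to the horizontal space, because z and its horizontal
  -- part are, and to the vertical space, which is isotropic; nondegeneracy makes it zero.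
  have hv0 : v = 0 := by
    refine eq_zero_of_symplecticForm_eq_zero fun w => ?_
    obtain ⟨h', hh', v', hv', rfl⟩ := Submodule.mem_sup.1
      (show w ∈ A.hor ξ ⊔ vertical ξ by rw [(A.isCompl ξ).sup_eq_top]; exact Submodule.mem_top)
    have h1 : symplecticForm ξ h' (h + v) = symplecticForm ξ h' h + symplecticForm ξ h' v :=
      map_add (symplecticMap ξ h') h v
    rw [hz h' hh', hA h' hh' h hh, zero_add] at h1
    refine (map_add (symplecticMap ξ v) h' v').trans ?_
    have h2 : symplecticMap ξ v h' = 0 :=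
      (symplecticForm_swap ξ v h').trans (neg_eq_zero.2 h1.symm)
    have h3 : symplecticMap ξ v v' = 0 := symplecticForm_eq_zero_of_vertical hv hv'
    rw [h2, h3, add_zero]
  rw [hv0, add_zero]
  exact hh

theorem EhresmannConnection.nabla_eq_zero_iff (A : EhresmannConnection n M)
    (X : ∀ x : M, TangentSpace (𝓡 n) x) (f : CotangentBundle n M → ℝ) (ξ : CotangentBundle n M) :
    A.nabla X f ξ = 0 ↔
      symplecticForm ξ (A.lift ξ (X ξ.proj)) (hamiltonianField f ξ) = 0 := by
  rw [symplecticForm_hamiltonianField]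
  rfl

theorem EhresmannConnection.lift_mem_hor (A : EhresmannConnection n M) (ξ : CotangentBundle n M)
    (v : TangentSpace (𝓡 n) ξ.proj) : A.lift ξ v ∈ A.hor ξ :=
  (A.existsUnique_lift ξ v).choose_spec.1.1

theorem SubRiemannianStructure.IsCanonicalConnection.isIsotropicAt_and_mem [T2Space M]
    {S : SubRiemannianStructure n M} {A : EhresmannConnection n M}
    (hA : S.IsCanonicalConnection A) {ξ : CotangentBundle n M} (hξ : ξ ∈ S.regularCovectors) :
    A.IsIsotropicAt ξ ∧ hamiltonianField S.hamiltonian ξ ∈ A.hor ξ := by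
  obtain ⟨ε, hε, lam, hlam, rfl, T, -, -, -, μ, -, E, F, R, hfr, hhor⟩ := hA ξ hξ
  have h0 : (0 : ℝ) ∈ Ioo (-ε) ε := ⟨by linarith, hε⟩
  rw [EhresmannConnection.IsIsotropicAt, hhor]
  refine ⟨fun v hv w hw => symplecticForm_eq_zero_of_span ?_ hv hw, ?_⟩
  · rintro _ ⟨c, hc, rfl⟩ _ ⟨d, hd, rfl⟩
    exact hfr.darboux_FF 0 h0 c hc d hd
  · exact hfr.mem_span_of_symplecticForm_eq_zero h0 fun c hc =>
      hfr.symplecticForm_hamiltonianField_eq_zero S.contMDiff_hamiltonian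
        S.hamiltonian_fiberScale hlam h0 hc

/-! ### Passage to the closure. -/

theorem continuousAt_chartDeriv {Y : ∀ ξ : CotangentBundle n M, TangentSpace (cotModel n) ξ}
    {ξ : CotangentBundle n M} (hY : ContMDiffAt (cotModel n) (cotModel n).tangent ∞ (fun ξ =>
      (⟨ξ, Y ξ⟩ : TangentBundle (cotModel n) (CotangentBundle n M))) ξ) :
    ContinuousAt (fun η => chartDeriv ξ η (Y η)) ξ := by
  have h1 := ((contMDiffAt_section ξ).1 hY).continuousAt
  refine h1.congr ?_
  filter_upwards [extChartAt_source_mem_nhds (I := cotModel n) ξ] with η hη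
  exact trivializationAt_eq_chartDeriv hη (Y η)

theorem continuousAt_symplecticForm
    {Y Y' : ∀ ξ : CotangentBundle n M, TangentSpace (cotModel n) ξ} {ξ : CotangentBundle n M}
    (hY : ContMDiffAt (cotModel n) (cotModel n).tangent ∞ (fun ξ =>
      (⟨ξ, Y ξ⟩ : TangentBundle (cotModel n) (CotangentBundle n M))) ξ)
    (hY' : ContMDiffAt (cotModel n) (cotModel n).tangent ∞ (fun ξ =>
      (⟨ξ, Y' ξ⟩ : TangentBundle (cotModel n) (CotangentBundle n M))) ξ) :
    ContinuousAt (fun η => symplecticForm η (Y η) (Y' η)) ξ := by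
  have h1 := continuousAt_chartDeriv hY
  have h2 := continuousAt_chartDeriv hY'
  have h3 : ContinuousAt (fun η => standardForm (chartDeriv ξ η (Y η)) (chartDeriv ξ η (Y' η))) ξ :=
    (h1.snd.clm_apply h2.fst).sub (h2.snd.clm_apply h1.fst)
  refine h3.congr ?_
  filter_upwards [extChartAt_source_mem_nhds (I := cotModel n) ξ] with η hη
  exact (symplecticForm_eq_standardForm hη _ _).symm

theorem eq_zero_of_mem_closure_of_continuousAt {X : Type*} [TopologicalSpace X] {u : X → ℝ}
    {s V : Set X} {x : X} (hu : ContinuousAt u x) (hV : V ∈ 𝓝 x) (hx : x ∈ closure s)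
    (h : ∀ z ∈ V ∩ s, u z = 0) : u x = 0 := by
  by_contra hne
  obtain ⟨z, ⟨hz1, hz2⟩, hz3⟩ := mem_closure_iff_nhds.1 hx _
    (inter_mem hV (hu.eventually_ne hne))
  exact hz2 (h z ⟨hz1, hz3⟩)

/-- If the horizontal distribution is smooth, isotropic and contains `f⃗` on a set, then the same
holds at the points of its closure. -/
theorem EhresmannConnection.isIsotropicAt_and_mem_of_mem_closure {A : EhresmannConnection n M}
    {f : CotangentBundle n M → ℝ} (hf : ContMDiff (cotModel n) 𝓘(ℝ, ℝ) ∞ f)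
    {U N : Set (CotangentBundle n M)} (hU : A.IsSmoothOn U)
    (hN : ∀ ξ ∈ N, A.IsIsotropicAt ξ ∧ hamiltonianField f ξ ∈ A.hor ξ) {ξ : CotangentBundle n M}
    (hξU : ξ ∈ U) (hξN : ξ ∈ closure N) :
    A.IsIsotropicAt ξ ∧ hamiltonianField f ξ ∈ A.hor ξ := by
  obtain ⟨V, hV, Y, hY, hspan⟩ := hU ξ hξU
  have hmem : ∀ η ∈ V, ∀ i, Y i η ∈ A.hor η := fun η hη i => by
    rw [← hspan η hη]; exact Submodule.subset_span ⟨i, rfl⟩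
  have hYξ := fun i => (hY i).contMDiffAt hV
  -- Isotropy is extended first: it turns membership of the Hamiltonian field in the horizontal
  -- space into skew-orthogonality to the frame, a condition that passes to limits.
  have hiso : A.IsIsotropicAt ξ := by
    intro v hv w hw
    rw [← hspan ξ (mem_of_mem_nhds hV)] at hv hw
    refine symplecticForm_eq_zero_of_span ?_ hv hw
    rintro _ ⟨i, rfl⟩ _ ⟨j, rfl⟩
    exact eq_zero_of_mem_closure_of_continuousAt (u := fun η => symplecticForm η (Y i η) (Y j η))
      (continuousAt_symplecticForm (hYξ i) (hYξ j)) hV hξN fun η hη => (hN η hη.2).1 _ (hmem η hη.1 i) _ (hmem η hη.1 j)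
  refine ⟨hiso, hiso.mem_hor fun w hw => ?_⟩
  rw [← hspan ξ (mem_of_mem_nhds hV)] at hw
  refine symplecticForm_eq_zero_of_span (t := {hamiltonianField f ξ}) ?_ hw
    (Submodule.mem_span_singleton_self _)
  rintro _ ⟨i, rfl⟩ _ rfl
  exact eq_zero_of_mem_closure_of_continuousAt
    (u := fun η => symplecticForm η (Y i η) (hamiltonianField f η))
    (continuousAt_symplecticForm (hYξ i) (contMDiff_hamiltonianField hf ξ)) hV hξN
    fun η hη => (hN η hη.2).1 _ (hmem η hη.1 i) _ (hN η hη.2).2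

end SubRiemannianGeometry

theorem mainTheorem2 {n : ℕ} {M : Type*} [TopologicalSpace M] [T2Space M]
    [SecondCountableTopology M] [ChartedSpace (Model n) M] [IsManifold (𝓡 n) ∞ M]
    (S : SubRiemannianStructure n M) (A : EhresmannConnection n M)
    (hA : S.IsCanonicalConnection A) :
    (∀ ξ ∈ S.regularCovectors,
      (∀ X : ∀ x : M, TangentSpace (𝓡 n) x, IsSmoothFieldOn X univ →
        A.nabla X S.hamiltonian ξ = 0) ∧
      hamiltonianField S.hamiltonian ξ ∈ A.hor ξ) ∧
    (∀ U : Set (CotangentBundle n M), IsOpen U → A.IsSmoothOn U →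
      ∀ ξ ∈ U ∩ closure S.regularCovectors,
      (∀ X : ∀ x : M, TangentSpace (𝓡 n) x, IsSmoothFieldOn X univ →
        A.nabla X S.hamiltonian ξ = 0) ∧
      hamiltonianField S.hamiltonian ξ ∈ A.hor ξ) := by
  have conclude : ∀ ξ, A.IsIsotropicAt ξ ∧ hamiltonianField S.hamiltonian ξ ∈ A.hor ξ →
      (∀ X : ∀ x : M, TangentSpace (𝓡 n) x, IsSmoothFieldOn X univ →
        A.nabla X S.hamiltonian ξ = 0) ∧ hamiltonianField S.hamiltonian ξ ∈ A.hor ξ :=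
    fun ξ h => ⟨fun X _ => (A.nabla_eq_zero_iff X _ ξ).2
      (h.1 _ (A.lift_mem_hor ξ _) _ h.2), h.2⟩
  exact ⟨fun ξ hξ => conclude ξ (hA.isIsotropicAt_and_mem hξ), fun U _ hU ξ hξ => conclude ξ
    (EhresmannConnection.isIsotropicAt_and_mem_of_mem_closure S.contMDiff_hamiltonian hU
      (fun η hη => hA.isIsotropicAt_and_mem hη) hξ.1 hξ.2)⟩
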